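/- Let $d\ge 1$ and let $\mathbb{L}^d=(\mathbb{Z}^d,\mathcal{E}^d)$ be the hypercubic lattice with nearest-neighbour edges. Let $k$ be an integer with $1\le k\le 2d$, and let $U=(U_e)_{e\in\mathcal{E}^d}$ be i.i.d. random variables, uniform on $[0,1]$. Constrained-degree percolation with constraint $k$ is the following process of open and closed edges in time $t\in[0,1]$. An edge $e=\langle u,v\rangle$ opens at time $U_e$, and remains open from then on, if at every time $s<U_e$ both $u$ and $v$ are incident to fewer than $k$ open edges; otherwise $e$ is closed at all times. Thus $e$ is open at time $t$ if and only if $U_e\le t$ and, for all $s\in[0,U_e)$, $$\max\bigl\{|\{x:\langle x,u\rangle\text{ is open at time }s\}|,\ |\{x:\langle x,v\rangle\text{ is open at time }s\}|\bigr\}<k .$$ Let $\mathcal{N}_t$ be the number of infinite connected components of the graph on $\mathbb{Z}^d$ whose edges are the edges open at time $t$. Theorem. For every fixed $t\in[0,1)$, almost surely the above rule determines the process (exactly one family of configurations indexed by $[0,1]$ satisfies it for the clocks $U$), and $\mathcal{N}_t\in\{0,1\}$. -/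

import Mathlib

open MeasureTheory
open scoped unitInterval

namespace CDP

/-- The hypercubic lattice on `ℤ^d`: two sites are adjacent when their `ℓ¹` distance is `1`. -/
def lattice (d : ℕ) : SimpleGraph (Fin d → ℤ) where
  Adj x y := ∑ i, |x i - y i| = 1
  symm := ⟨fun x y h => by simpa only [abs_sub_comm] using h⟩
  loopless := ⟨fun x h => by simp at h⟩

/-- The edges of the hypercubic lattice. -/
abbrev Edge (d : ℕ) : Type := (lattice d).edgeSet

/-- The law of the clocks: independent, uniform on `[0, 1]`, one for each edge. -/
noncomputable def clockLaw (d : ℕ) : Measure (Edge d → I) :=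
  Measure.infinitePi fun _ => (volume : Measure I)

/-- The graph on `ℤ^d` whose edges are the open ones, where `η` is the set of open edges. -/
def openGraph {d : ℕ} (η : Set (Edge d)) : SimpleGraph (Fin d → ℤ) where
  Adj x y := ∃ h : (lattice d).Adj x y, ⟨s(x, y), h⟩ ∈ η
  symm := ⟨fun x y ⟨h, hη⟩ => ⟨h.symm, by simpa only [Sym2.eq_swap] using hη⟩⟩
  loopless := ⟨fun x ⟨h, _⟩ => (lattice d).irrefl h⟩

/-- The number of open edges at the site `x`, i.e. of its neighbours through open edges. -/
noncomputable def openDegree {d : ℕ} (η : Set (Edge d)) (x : Fin d → ℤ) : ℕ∞ :=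
  ((openGraph η).neighborSet x).encard

/-- `ω` (giving the set `ω t` of open edges at each time `t ∈ [0, 1]`) is a trajectory of
constrained-degree percolation with constraint `k` driven by the clocks `U`: the edge `e` opens at
time `U e`, and then stays open, if at all times `s < U e` both of its endpoints have
fewer than `k` open edges; otherwise it is closed at all times. -/
def IsTrajectory {d : ℕ} (k : ℕ) (U : Edge d → I) (ω : I → Set (Edge d)) : Prop :=
  ∀ (t : I) (e : Edge d), e ∈ ω t ↔
    U e ≤ t ∧ ∀ s : I, s < U e → ∀ v ∈ (e : Sym2 (Fin d → ℤ)), openDegree (ω s) v < k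

/-- The number (possibly infinite) of infinite open clusters, i.e. of infinite connected
components of the graph of open edges. -/
noncomputable def numInfiniteClusters {d : ℕ} (η : Set (Edge d)) : ℕ∞ :=
  {C : (openGraph η).ConnectedComponent | C.supp.Infinite}.encard

end CDP

/-! Almost surely no infinite chain of touching edges has decreasing clocks: its clocks would
eventually stay in one short time slab, where a first-moment bound excludes long chains
(`ae_wellOrderedClocks`). Whether an edge opens is then settled by well-founded recursion on earlier
touching edges. This yields existence and uniqueness of the trajectory, and the version `openAt`,
which is measurable and commutes with translations.

Uniqueness of the infinite cluster follows Burton and Keane, but the constraint spoils the usual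
finite-energy property. Its substitute is `openAt_eq_of_modify` with `ae_modify_notMem`. For `0 < t
< 1` one may close a finite set `F` of edges and reopen any `A ⊆ F`, provided all degrees stay at
most `k`: the clocks of `F \ A` and of the closed edges touching `F` are moved past `t`, and those
of `A` are put just before `t`, after the other open edges touching `F` have rung. Only resampling
of finitely many clocks is involved, so such a change cannot reach a null event.

By stationarity, a random set of sites never outnumbering the shell of a box is almost surely empty.
If `k ≤ 2`, this excludes endpoints of infinite clusters; as closing one edge of an infinite cluster
creates an endpoint, there is no infinite cluster. If `k ≥ 3`, it excludes trifurcations, and three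
infinite clusters could be modified into one (`exists_modify_isTrifurcation`), so there are at most
two.

By the zero-one law, having two infinite clusters has probability 0 or 1. If it were almost sure,
join two of them by a modification (`exists_modify_join`). Two infinite clusters must still remain,
so the closing step alone had produced three, which is a null event. -/

namespace CDP

/-! ### Product measures: resampling, relabelling, and a zero-one law -/

section Product

variable {ι X : Type*} [MeasurableSpace X] (ν : Measure X) [IsProbabilityMeasure ν]

/-- Resampling finitely many coordinates of a product measure preserves it. -/
theorem measurePreserving_piecewise [DecidableEq ι] (H : Finset ι) :
    MeasurePreserving (fun p : (ι → X) × (ι → X) => H.piecewise p.2 p.1)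
      ((Measure.infinitePi fun _ => ν).prod (Measure.infinitePi fun _ => ν))
      (Measure.infinitePi fun _ => ν) := by
  have hm : Measurable (fun p : (ι → X) × (ι → X) => H.piecewise p.2 p.1) := by
    refine measurable_pi_lambda _ fun i => ?_
    by_cases hi : i ∈ H
    · simp only [Finset.piecewise, hi, if_true]; fun_prop
    · simp only [Finset.piecewise, hi, if_false]; fun_prop
  refine ⟨hm, Measure.eq_infinitePi _ fun s t ht => ?_⟩
  rw [Measure.map_apply hm (MeasurableSet.pi s.countable_toSet fun i _ => ht i)]
  have : (fun p : (ι → X) × (ι → X) => H.piecewise p.2 p.1) ⁻¹' Set.pi s t =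
      Set.pi (s \ H : Finset ι) t ×ˢ Set.pi (s ∩ H : Finset ι) t := by
    ext ⟨U, V⟩
    simp only [Set.mem_preimage, Set.mem_pi, Set.mem_prod, Finset.mem_coe, Finset.mem_sdiff,
      Finset.mem_inter]
    constructor
    · intro h
      refine ⟨fun i hi => ?_, fun i hi => ?_⟩
      · simpa [hi.2] using h i hi.1
      · simpa [hi.2] using h i hi.1
    · rintro ⟨h1, h2⟩ i hi
      by_cases hiH : i ∈ H
      · simpa [hiH] using h2 i ⟨hi, hiH⟩
      · simpa [hiH] using h1 i ⟨hi, hiH⟩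
  rw [this, Measure.prod_prod, Measure.infinitePi_pi _ fun i _ => ht i,
    Measure.infinitePi_pi _ fun i _ => ht i, mul_comm, Finset.prod_inter_mul_prod_sdiff]

theorem measurePreserving_comp_equiv (ρ : ι ≃ ι) :
    MeasurePreserving (fun U : ι → X => U ∘ ρ)
      (Measure.infinitePi fun _ => ν) (Measure.infinitePi fun _ => ν) := by
  refine ⟨by fun_prop, ?_⟩
  have := Measure.infinitePi_map_piCongrLeft (fun _ : ι => ν) ρ.symm
  convert this using 2
  ext U i
  have := Equiv.piCongrLeft_apply_apply (fun _ : ι => X) ρ.symm U (ρ i)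
  rw [MeasurableEquiv.coe_piCongrLeft]
  simpa using this.symm

theorem ae_apply_ne_const [MeasurableSingletonClass X] [NullSingletonClass ν] (i : ι) (c : X) :
    ∀ᵐ U ∂(Measure.infinitePi fun _ : ι => ν), U i ≠ c := by
  have h := (measurePreserving_eval_infinitePi (fun _ : ι => ν) i).quasiMeasurePreserving
  exact h.ae (p := fun x => x ≠ c) (by simp [ae_iff])

theorem ae_apply_ne_apply [MeasurableSingletonClass X] [MeasurableEq X] [NullSingletonClass ν]
    {i j : ι} (hij : i ≠ j) :
    ∀ᵐ U ∂(Measure.infinitePi fun _ : ι => ν), U i ≠ U j := by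
  classical
  have h := measurePreserving_piecewise ν ({j} : Finset ι)
  have hs : MeasurableSet {U : ι → X | U i ≠ U j} :=
    (measurableSet_eq_fun (measurable_pi_apply i) (measurable_pi_apply j)).compl
  rw [← h.map_eq, ae_map_iff h.measurable.aemeasurable hs]
  have h2 : ∀ᵐ p ∂((Measure.infinitePi fun _ : ι => ν).prod (Measure.infinitePi fun _ => ν)),
      p.1 i ≠ p.2 j := by
    refine (Measure.ae_prod_iff_ae_ae ?_).2 (Filter.Eventually.of_forall fun U => ?_)
    · exact (measurableSet_eq_fun ((measurable_pi_apply i).comp measurable_fst)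
        ((measurable_pi_apply j).comp measurable_snd)).compl
    · filter_upwards [ae_apply_ne_const ν j (U i)] with V hV using hV.symm
  filter_upwards [h2] with p hp
  simpa [Finset.piecewise, hij] using hp

/-- Mixing: `A` is close to a cylinder `B` over `H`, and by invariance also to the relabelled
cylinder, which is independent of `B` because `ρ` moves `H` off itself. Hence `P(A)` is arbitrarily
close to `P(A)²`. -/
theorem measure_eq_zero_or_one_of_invariant {A : Set (ι → X)} (hA : MeasurableSet A)
    (hinv : ∀ H : Finset ι, ∃ ρ : ι ≃ ι, (∀ i ∈ H, ρ i ∉ H) ∧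
      (fun U : ι → X => U ∘ ρ) ⁻¹' A =ᵐ[Measure.infinitePi fun _ => ν] A) :
    (Measure.infinitePi fun _ => ν) A = 0 ∨ (Measure.infinitePi fun _ => ν) A = 1 := by
  classical
  set P : Measure (ι → X) := Measure.infinitePi fun _ => ν with hP
  have hdense : P.MeasureDense (measurableCylinders fun _ : ι => X) :=
    .of_generateFrom_isSetAlgebra_finite P isSetAlgebra_measurableCylinders
      generateFrom_measurableCylinders.symm
  have key : ∀ ε : ℝ, 0 < ε → |P.real A - P.real A ^ 2| ≤ 4 * ε := by
    intro ε hε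
    obtain ⟨B, hB, hAB⟩ := hdense.approx A hA (measure_ne_top _ _) ε hε
    obtain ⟨H, S, hS, rfl⟩ := (mem_measurableCylinders B).1 hB
    obtain ⟨ρ, hρ, hinvρ⟩ := hinv H
    have hBm := hdense.measurable _ hB
    set B : Set (ι → X) := cylinder (α := fun _ => X) H S
    set τ : (ι → X) → (ι → X) := fun U => U ∘ ρ
    have hτ : MeasurePreserving τ P P := measurePreserving_comp_equiv ν ρ
    have hB'm : MeasurableSet (τ ⁻¹' B) := hτ.measurable hBm
    have hreal : P.real (symmDiff A B) ≤ ε :=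
      ENNReal.toReal_le_of_le_ofReal hε.le hAB.le
    have hreal' : P.real (symmDiff A (τ ⁻¹' B)) ≤ ε := by
      have : P.real (symmDiff A (τ ⁻¹' B)) = P.real (τ ⁻¹' (symmDiff A B)) := by
        rw [Set.preimage_symmDiff]
        exact measureReal_congr (ae_eq_set_symmDiff hinvρ.symm (ae_eq_refl _))
      rw [this, measureReal_def, hτ.measure_preimage (hA.symmDiff hBm).nullMeasurableSet]
      exact hreal
    -- Independence is read off from resampling: once `H` is redrawn from `V`, the event `B` depends
    -- on `V` alone and `τ ⁻¹' B` on `U` alone.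
    have hind : P.real (B ∩ τ ⁻¹' B) = P.real B * P.real B := by
      have h := measurePreserving_piecewise ν H
      rw [measureReal_def, ← h.measure_preimage (hBm.inter hB'm).nullMeasurableSet]
      have : (fun p : (ι → X) × (ι → X) => H.piecewise p.2 p.1) ⁻¹' (B ∩ τ ⁻¹' B) =
          (τ ⁻¹' B) ×ˢ B := by
        ext ⟨U, V⟩
        have e1 : H.restrict (H.piecewise V U) = H.restrict V := by
          ext i; simp
        have e2 : H.restrict (H.piecewise V U ∘ ρ) = H.restrict (U ∘ ρ) := by
          ext i
          simp [Finset.piecewise, hρ i i.2]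
        simp only [B, τ, Set.mem_preimage, Set.mem_inter_iff, mem_cylinder, Set.mem_prod, e1, e2]
        exact and_comm
      rw [this, Measure.prod_prod, ENNReal.toReal_mul, ← measureReal_def, ← measureReal_def]
      congr 1
      rw [measureReal_def, hτ.measure_preimage hBm.nullMeasurableSet, measureReal_def]
    have h1 := (abs_measureReal_sub_le_measureReal_symmDiff (μ := P) hA.nullMeasurableSet hBm.nullMeasurableSet).trans hreal
    have h2 : |P.real A - P.real (B ∩ τ ⁻¹' B)| ≤ 2 * ε := by
      refine (abs_measureReal_sub_le_measureReal_symmDiff hA.nullMeasurableSet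
        (hBm.inter hB'm).nullMeasurableSet).trans ?_
      have : symmDiff A (B ∩ τ ⁻¹' B) ⊆ symmDiff A B ∪ symmDiff A (τ ⁻¹' B) := by
        intro x
        simp only [Set.mem_symmDiff, Set.mem_inter_iff, Set.mem_union]
        tauto
      have := (measureReal_mono (μ := P) this).trans (measureReal_union_le _ _)
      linarith
    rw [hind] at h2
    have hA1 : P.real A ≤ 1 := measureReal_le_one
    have hB1 : P.real B ≤ 1 := measureReal_le_one
    have hA0 : 0 ≤ P.real A := measureReal_nonneg
    have hB0 : 0 ≤ P.real B := measureReal_nonneg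
    have h3 : |P.real B * P.real B - P.real A ^ 2| ≤ 2 * ε := by
      have : P.real B * P.real B - P.real A ^ 2 = -((P.real A - P.real B) * (P.real A + P.real B)) := by
        ring
      rw [this, abs_neg, abs_mul, mul_comm, abs_of_nonneg (by linarith : 0 ≤ P.real A + P.real B)]
      nlinarith [abs_nonneg (P.real A - P.real B)]
    have := abs_sub_le (P.real A) (P.real B * P.real B) (P.real A ^ 2)
    linarith
  have h0 : P.real A - P.real A ^ 2 = 0 := by
    rw [← abs_nonpos_iff]
    refine le_of_forall_pos_le_add fun ε hε => ?_
    have := key (ε / 4) (by positivity)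
    linarith
  have h1 : P.real A * (1 - P.real A) = 0 := by linarith
  rcases mul_eq_zero.1 h1 with h | h
  · left
    rwa [measureReal_eq_zero_iff] at h
  · right
    have h : P.real A = 1 := by linarith
    rw [← ENNReal.toReal_eq_one_iff]
    exact h

end Product

/-! ### The lattice: adjacency, connectedness, touching edges, translations -/

section Lattice

variable {d : ℕ}

instance : Countable (Edge d) := by
  have : Countable (Sym2 (Fin d → ℤ)) := inferInstanceAs (Countable (Quot _))
  infer_instance

/-- The neighbours of the origin. -/
noncomputable def unitSteps (d : ℕ) : Finset (Fin d → ℤ) :=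
  (Finset.Icc (-1) 1).filter fun v => ∑ i, |v i| = 1

theorem lattice_adj_add_iff {x v : Fin d → ℤ} : (lattice d).Adj x (x + v) ↔ v ∈ unitSteps d := by
  simp only [lattice, unitSteps, Finset.mem_filter, Pi.add_apply, sub_add_cancel_left, abs_neg,
    iff_and_self, Finset.mem_Icc, Pi.le_def]
  intro h
  have hv : ∀ i, |v i| ≤ 1 := fun i =>
    h ▸ Finset.single_le_sum (f := fun i => |v i|) (fun j _ => abs_nonneg _) (Finset.mem_univ i)
  exact ⟨fun i => (abs_le.1 (hv i)).1, fun i => (abs_le.1 (hv i)).2⟩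

theorem lattice_adj_abs_le {x y : Fin d → ℤ} (h : (lattice d).Adj x y) (i : Fin d) :
    |x i - y i| ≤ 1 := by
  have h : ∑ i, |x i - y i| = 1 := h
  exact h ▸ Finset.single_le_sum (f := fun i => |x i - y i|) (fun j _ => abs_nonneg _)
    (Finset.mem_univ i)

theorem lattice_adj_add_right {x y : Fin d → ℤ} (a : Fin d → ℤ) :
    (lattice d).Adj (x + a) (y + a) ↔ (lattice d).Adj x y := by
  simp [lattice]

theorem lattice_preconnected (d : ℕ) : (lattice d).Preconnected := by
  have key : ∀ (n : ℕ) (x y : Fin d → ℤ), ∑ i, (x i - y i).natAbs ≤ n →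
      (lattice d).Reachable x y := by
    intro n
    induction n with
    | zero =>
      intro x y h
      have : x = y := by
        ext i
        have := (Finset.sum_eq_zero_iff.1 (Nat.le_zero.1 h)) i (Finset.mem_univ i)
        omega
      rw [this]
    | succ n ih =>
      intro x y h
      by_cases hxy : x = y
      · rw [hxy]
      obtain ⟨i, hi⟩ := Function.ne_iff.1 hxy
      obtain ⟨c, hc, hc'⟩ : ∃ c : ℤ, |x i - c| = 1 ∧ (c - y i).natAbs + 1 = (x i - y i).natAbs := by
        rcases lt_or_gt_of_ne hi with h | h
        · exact ⟨x i + 1, by simp, by omega⟩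
        · exact ⟨x i - 1, by simp, by omega⟩
      have hadj : (lattice d).Adj x (Function.update x i c) := by
        change ∑ j, |x j - Function.update x i c j| = 1
        rw [Finset.sum_eq_single i]
        · simpa using hc
        · intro j _ hj; simp [hj]
        · simp
      refine hadj.reachable.trans (ih _ _ ?_)
      rw [← Finset.add_sum_erase _ _ (Finset.mem_univ i)] at h ⊢
      have : ∑ j ∈ Finset.univ.erase i, (Function.update x i c j - y j).natAbs =
          ∑ j ∈ Finset.univ.erase i, (x j - y j).natAbs :=
        Finset.sum_congr rfl fun j hj => by simp [Finset.ne_of_mem_erase hj]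
      rw [this]
      simp only [Function.update_self]
      omega
  exact fun x y => key _ x y le_rfl

/-- The edge between adjacent sites. -/
def mkEdge {x y : Fin d → ℤ} (h : (lattice d).Adj x y) : Edge d := ⟨s(x, y), h⟩

theorem exists_eq_mkEdge {e : Edge d} {x : Fin d → ℤ} (h : x ∈ (e : Sym2 (Fin d → ℤ))) :
    ∃ (y : Fin d → ℤ) (hxy : (lattice d).Adj x y), e = mkEdge hxy := by
  obtain ⟨e, he⟩ := e
  obtain ⟨y, rfl⟩ := Sym2.mem_iff_exists.1 h
  exact ⟨y, he, rfl⟩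

theorem mem_mkEdge {x y z : Fin d → ℤ} (h : (lattice d).Adj x y) :
    z ∈ (mkEdge h : Sym2 (Fin d → ℤ)) ↔ z = x ∨ z = y := Sym2.mem_iff

theorem mkEdge_symm {x y : Fin d → ℤ} (h : (lattice d).Adj x y) : mkEdge h.symm = mkEdge h :=
  Subtype.ext Sym2.eq_swap

theorem mkEdge_inj {x y z : Fin d → ℤ} {h : (lattice d).Adj x y} {h' : (lattice d).Adj x z} :
    mkEdge h = mkEdge h' ↔ y = z := by
  simp only [mkEdge, Subtype.ext_iff, Sym2.eq_iff, true_and, or_iff_left_iff_imp]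
  rintro ⟨rfl, rfl⟩; rfl

open scoped Classical in
/-- The edges at a site. -/
noncomputable def edgesAt (x : Fin d → ℤ) : Finset (Edge d) :=
  (unitSteps d).attach.image fun v => mkEdge (lattice_adj_add_iff (x := x).2 v.2)

@[simp]
theorem mem_edgesAt {x : Fin d → ℤ} {e : Edge d} :
    e ∈ edgesAt x ↔ x ∈ (e : Sym2 (Fin d → ℤ)) := by
  simp only [edgesAt, Finset.mem_image, Finset.mem_attach, true_and, Subtype.exists]
  constructor
  · rintro ⟨v, hv, rfl⟩
    exact (mem_mkEdge _).2 (Or.inl rfl)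
  · intro h
    obtain ⟨y, hy, rfl⟩ := exists_eq_mkEdge h
    refine ⟨y - x, ?_, ?_⟩
    · rw [← lattice_adj_add_iff (x := x)]
      simpa using hy
    · rw [mkEdge_inj]; simp

theorem card_edgesAt_le (x : Fin d → ℤ) : (edgesAt x).card ≤ (unitSteps d).card := by
  classical
  exact Finset.card_image_le.trans (Finset.card_attach).le

open scoped Classical in
/-- The edges touching a finite set of sites. -/
noncomputable def edgesTouching (S : Finset (Fin d → ℤ)) : Finset (Edge d) :=
  S.biUnion edgesAt

@[simp]
theorem mem_edgesTouching {S : Finset (Fin d → ℤ)} {e : Edge d} :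
    e ∈ edgesTouching S ↔ ∃ x ∈ S, x ∈ (e : Sym2 (Fin d → ℤ)) := by
  simp [edgesTouching]

open scoped Classical in
/-- The edges sharing a site with a given edge. -/
noncomputable def nearEdges (e : Edge d) : Finset (Edge d) :=
  edgesTouching (Sym2.toFinset (e : Sym2 (Fin d → ℤ)))

/-- Two edges touch when they share a site. -/
def Touch (f e : Edge d) : Prop := ∃ v ∈ (f : Sym2 (Fin d → ℤ)), v ∈ (e : Sym2 (Fin d → ℤ))

@[simp]
theorem mem_nearEdges {f e : Edge d} : f ∈ nearEdges e ↔ Touch f e := by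
  simp [nearEdges, Touch, and_comm]

theorem card_nearEdges_le (e : Edge d) : (nearEdges e).card ≤ 2 * (unitSteps d).card := by
  classical
  refine Finset.card_biUnion_le.trans ((Finset.sum_le_card_nsmul _ _ _ fun x _ =>
    card_edgesAt_le x).trans ?_)
  have : (Sym2.toFinset (e : Sym2 (Fin d → ℤ))).card ≤ 2 := by
    obtain ⟨e, he⟩ := e
    induction e using Sym2.ind with
    | _ x y =>
      rw [Sym2.toFinset_mk_eq]
      exact Finset.card_le_two
  rw [smul_eq_mul]
  gcongr

/-- Translation of the lattice. -/
def shift (a : Fin d → ℤ) : lattice d ≃g lattice d where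
  toEquiv := Equiv.addRight a
  map_rel_iff' := lattice_adj_add_right a

/-- Translation of the edges. -/
def shiftEdge (a : Fin d → ℤ) : Edge d ≃ Edge d := (shift a).mapEdgeSet

@[simp]
theorem mem_shiftEdge {a x : Fin d → ℤ} {e : Edge d} :
    x + a ∈ (shiftEdge a e : Sym2 (Fin d → ℤ)) ↔ x ∈ (e : Sym2 (Fin d → ℤ)) := by
  obtain ⟨e, he⟩ := e
  induction e using Sym2.ind with
  | _ u v =>
    have : shiftEdge a ⟨s(u, v), he⟩ = mkEdge ((lattice_adj_add_right a).2 he) := rfl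
    rw [this, mem_mkEdge, Sym2.mem_iff]
    simp

theorem exists_shift_disjoint (hd : 0 < d) (H : Finset (Edge d)) :
    ∃ a : Fin d → ℤ, ∀ e ∈ H, shiftEdge a e ∉ H := by
  classical
  obtain ⟨M, hM⟩ : ∃ M : ℤ, ∀ e ∈ H, ∀ x ∈ (e : Sym2 (Fin d → ℤ)), |x ⟨0, hd⟩| < M := by
    obtain ⟨M, hM⟩ := (H.biUnion fun e => (Sym2.toFinset (e : Sym2 (Fin d → ℤ))).image
      fun x => |x ⟨0, hd⟩|).exists_le
    refine ⟨M + 1, fun e he x hx => Int.lt_add_one_iff.2 (hM _ ?_)⟩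
    simp only [Finset.mem_biUnion, Finset.mem_image, Sym2.mem_toFinset]
    exact ⟨e, he, x, hx, rfl⟩
  -- Zeroth coordinates in `H` lie strictly between `-M` and `M`; a shift by `2 * M` pushes them
  -- above `M`.
  refine ⟨fun _ => 2 * M, fun e he he' => ?_⟩
  obtain ⟨x, hx⟩ : ∃ x, x ∈ (e : Sym2 (Fin d → ℤ)) :=
    ⟨_, Sym2.out_fst_mem _⟩
  have h1 := hM e he x hx
  have h2 := hM _ he' _ ((mem_shiftEdge (a := fun _ => 2 * M)).2 hx)
  simp only [Pi.add_apply] at h2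
  rw [abs_lt] at h1 h2
  omega

end Lattice

/-! ### Open degrees of a configuration -/

section Config

variable {d : ℕ} {η ζ : Set (Edge d)} {x y v : Fin d → ℤ}

theorem openGraph_adj : (openGraph η).Adj x y ↔ ∃ h : (lattice d).Adj x y, mkEdge h ∈ η := Iff.rfl

theorem openGraph_le_lattice (η : Set (Edge d)) : openGraph η ≤ lattice d := fun _ _ h => h.1

theorem openGraph_mono (h : η ⊆ ζ) : openGraph η ≤ openGraph ζ := fun _ _ ⟨h1, h2⟩ => ⟨h1, h h2⟩

theorem openDegree_mono_at (h : ∀ e : Edge d, v ∈ (e : Sym2 (Fin d → ℤ)) → e ∈ η → e ∈ ζ) :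
    openDegree η v ≤ openDegree ζ v :=
  Set.encard_le_encard fun _ ⟨h1, h2⟩ => ⟨h1, h _ (Sym2.mem_mk_left _ _) h2⟩

theorem openDegree_congr_at (h : ∀ e : Edge d, v ∈ (e : Sym2 (Fin d → ℤ)) → (e ∈ η ↔ e ∈ ζ)) :
    openDegree η v = openDegree ζ v :=
  le_antisymm (openDegree_mono_at fun e he => (h e he).1) (openDegree_mono_at fun e he => (h e he).2)

theorem lattice_neighborSet_finite (v : Fin d → ℤ) : ((lattice d).neighborSet v).Finite := by
  refine ((unitSteps d).finite_toSet.image fun u => v + u).subset fun y hy => ?_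
  refine ⟨y - v, ?_, by simp⟩
  rw [Finset.mem_coe, ← lattice_adj_add_iff (x := v)]
  simpa using hy

theorem neighborSet_finite (η : Set (Edge d)) (v : Fin d → ℤ) :
    ((openGraph η).neighborSet v).Finite :=
  (lattice_neighborSet_finite v).subset fun _ h => h.1

/-- Local finiteness makes the inequality strict. This is the source of every free slot used later:
a site that loses an edge can accept another. -/
theorem openDegree_lt_of_ssubset {e : Edge d} (hv : v ∈ (e : Sym2 (Fin d → ℤ)))
    (h : ∀ f : Edge d, v ∈ (f : Sym2 (Fin d → ℤ)) → f ∈ η → f ∈ ζ) (he : e ∈ ζ) (he' : e ∉ η) :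
    openDegree η v < openDegree ζ v := by
  refine (neighborSet_finite η v).encard_lt_encard ⟨fun _ ⟨h1, h2⟩ =>
    ⟨h1, h _ (Sym2.mem_mk_left _ _) h2⟩, fun hle => ?_⟩
  obtain ⟨y, hy, rfl⟩ := exists_eq_mkEdge hv
  obtain ⟨h1, h2⟩ : (openGraph η).Adj v y := hle ⟨hy, he⟩
  exact he' h2

theorem openDegree_insert_le (e : Edge d) (v : Fin d → ℤ) :
    openDegree (insert e η) v ≤ openDegree η v + 1 := by
  by_cases hv : v ∈ (e : Sym2 (Fin d → ℤ))
  · obtain ⟨y, hy, rfl⟩ := exists_eq_mkEdge hv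
    refine le_trans (Set.encard_le_encard (t := insert y ((openGraph η).neighborSet v)) ?_)
      (Set.encard_insert_le _ _)
    rintro z ⟨h1, h2 | h2⟩
    · exact Or.inl (mkEdge_inj.1 h2)
    · exact Or.inr ⟨h1, h2⟩
  · refine le_trans (openDegree_mono_at fun f hf hf' => ?_) le_self_add
    rcases hf' with rfl | hf'
    · exact absurd hf hv
    · exact hf'

theorem openGraph_preimage_shiftEdge (a : Fin d → ℤ) (η : Set (Edge d)) :
    openGraph (shiftEdge a ⁻¹' η) = (openGraph η).comap (shift a) := by
  ext x y
  constructor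
  · rintro ⟨h1, h2⟩
    exact ⟨(lattice_adj_add_right a).2 h1, h2⟩
  · rintro ⟨h1, h2⟩
    exact ⟨(lattice_adj_add_right a).1 h1, h2⟩

theorem openDegree_preimage_shiftEdge (a : Fin d → ℤ) (η : Set (Edge d)) (v : Fin d → ℤ) :
    openDegree (shiftEdge a ⁻¹' η) v = openDegree η (v + a) := by
  have : (openGraph (shiftEdge a ⁻¹' η)).neighborSet v =
      (shift a) ⁻¹' (openGraph η).neighborSet (v + a) := by
    rw [openGraph_preimage_shiftEdge]; rfl
  rw [openDegree, openDegree, this, Set.encard_preimage_of_bijective (shift a).bijective]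

end Config

/-! ### Construction and uniqueness of the trajectory, and finite modifications -/

section Dynamics

variable {d : ℕ} {k : ℕ} {U U' : Edge d → I}

/-- The edge `f` touches `e` and rings before it. -/
def Precedes (U : Edge d → I) (f e : Edge d) : Prop := Touch f e ∧ U f < U e

/-- There is no infinite chain of touching edges with decreasing clocks. -/
def WellOrderedClocks (U : Edge d → I) : Prop := WellFounded (Precedes U)

/-- Approximations of the set of edges that ever open, by number of steps in the recursion. -/
def stage (k : ℕ) (U : Edge d → I) : ℕ → Set (Edge d)
  | 0 => ∅
  | n + 1 => {e | ∀ v ∈ (e : Sym2 (Fin d → ℤ)), openDegree {f ∈ stage k U n | U f < U e} v < k}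

/-- The edges that ever open. -/
def everOpen (k : ℕ) (U : Edge d → I) : Set (Edge d) := {e | ∀ᶠ n in Filter.atTop, e ∈ stage k U n}

/-- The edges open at time `t`. -/
def openAt (k : ℕ) (U : Edge d → I) (t : I) : Set (Edge d) := {e ∈ everOpen k U | U e ≤ t}

theorem mem_openAt {e : Edge d} {t : I} : e ∈ openAt k U t ↔ e ∈ everOpen k U ∧ U e ≤ t := Iff.rfl

/-- The recursion at `e` consults only the finitely many touching edges that ring earlier. Once
these have stabilised, so has `e` one stage later, and the limit solves the fixed-point equation. -/
theorem exists_stage_stable (hU : WellOrderedClocks U) (e : Edge d) :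
    (∃ N, ∀ n ≥ N, e ∈ stage k U n ↔ e ∈ everOpen k U) ∧
    (e ∈ everOpen k U ↔
      ∀ v ∈ (e : Sym2 (Fin d → ℤ)), openDegree {f ∈ everOpen k U | U f < U e} v < k) := by
  induction e using hU.induction with
  | _ e ih =>
    have : ∃ N, ∀ f ∈ nearEdges e, U f < U e → ∀ n ≥ N, f ∈ stage k U n ↔ f ∈ everOpen k U := by
      have h1 : ∀ f, ∃ N, f ∈ nearEdges e → U f < U e →
          ∀ n ≥ N, f ∈ stage k U n ↔ f ∈ everOpen k U := by
        intro f
        by_cases hf : f ∈ nearEdges e ∧ U f < U e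
        · obtain ⟨N, hN⟩ := (ih f ⟨mem_nearEdges.1 hf.1, hf.2⟩).1
          exact ⟨N, fun _ _ => hN⟩
        · exact ⟨0, fun h1 h2 => absurd ⟨h1, h2⟩ hf⟩
      choose N hN using h1
      exact ⟨(nearEdges e).sup N, fun f hf hf' n hn =>
        hN f hf hf' n (le_trans (Finset.le_sup (f := N) hf) hn)⟩
    obtain ⟨N, hN⟩ := this
    have hst : ∀ n ≥ N, e ∈ stage k U (n + 1) ↔
        ∀ v ∈ (e : Sym2 (Fin d → ℤ)), openDegree {f ∈ everOpen k U | U f < U e} v < k := by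
      intro n hn
      change (∀ v ∈ (e : Sym2 (Fin d → ℤ)), openDegree {f ∈ stage k U n | U f < U e} v < k) ↔ _
      refine forall₂_congr fun v hv => ?_
      rw [openDegree_congr_at fun f hf => ?_]
      simp only [Set.mem_ofPred_eq]
      exact and_congr_left fun hfe => hN f (mem_nearEdges.2 ⟨v, hf, hv⟩) hfe n hn
    have hst' : ∀ n ≥ N + 1, e ∈ stage k U n ↔
        ∀ v ∈ (e : Sym2 (Fin d → ℤ)), openDegree {f ∈ everOpen k U | U f < U e} v < k := by
      intro n hn
      obtain ⟨m, rfl⟩ := Nat.exists_eq_add_of_le' (le_trans (Nat.le_add_left 1 N) hn)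
      exact hst m (by omega)
    have hiff : e ∈ everOpen k U ↔
        ∀ v ∈ (e : Sym2 (Fin d → ℤ)), openDegree {f ∈ everOpen k U | U f < U e} v < k := by
      constructor
      · intro h
        obtain ⟨n, hn1, hn2⟩ := (h.and (Filter.eventually_ge_atTop (N + 1))).exists
        exact (hst' n hn2).1 hn1
      · intro h
        exact Filter.eventually_atTop.2 ⟨N + 1, fun n hn => (hst' n hn).2 h⟩
    exact ⟨⟨N + 1, fun n hn => (hst' n hn).trans hiff.symm⟩, hiff⟩

theorem mem_everOpen_iff (hU : WellOrderedClocks U) {e : Edge d} :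
    e ∈ everOpen k U ↔
      ∀ v ∈ (e : Sym2 (Fin d → ℤ)), openDegree {f ∈ everOpen k U | U f < U e} v < k :=
  (exists_stage_stable hU e).2

theorem openDegree_empty (v : Fin d → ℤ) : openDegree (∅ : Set (Edge d)) v = 0 := by
  rw [openDegree, Set.encard_eq_zero, Set.eq_empty_iff_forall_notMem]
  rintro y ⟨_, h⟩
  exact h

/-- The open edges at `v` that ring before `e` are finite in number, so all are already open when
the last of them rings; that time serves as `s`. If there are none, the degree is 0 and `1 ≤ k` is
what is needed. -/
theorem forall_openDegree_openAt_lt_iff (hk : 1 ≤ k) {e : Edge d} (v : Fin d → ℤ) :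
    (∀ s : I, s < U e → openDegree (openAt k U s) v < k) ↔
      openDegree {f ∈ everOpen k U | U f < U e} v < k := by
  classical
  constructor
  · intro h
    set T := (edgesAt v).filter fun f => f ∈ everOpen k U ∧ U f < U e with hT
    rcases T.eq_empty_or_nonempty with hempty | hne
    · rw [openDegree_congr_at (ζ := ∅), openDegree_empty]
      · exact_mod_cast hk
      · intro f hf
        refine iff_of_false (fun hf' => ?_) (Set.notMem_empty _)
        have : f ∈ T := by simpa [hT, hf] using hf'
        simp [hempty] at this
    · obtain ⟨g, hg, hmax⟩ := T.exists_max_image U hne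
      have hg' : v ∈ (g : Sym2 (Fin d → ℤ)) ∧ g ∈ everOpen k U ∧ U g < U e := by
        simpa [hT] using hg
      refine lt_of_le_of_lt (openDegree_mono_at fun f hf hf' => ?_) (h (U g) hg'.2.2)
      exact ⟨hf'.1, hmax f (by simpa [hT, hf] using hf')⟩
  · intro h s hs
    refine lt_of_le_of_lt (openDegree_mono_at fun f _ hf => ?_) h
    exact ⟨hf.1, hf.2.trans_lt hs⟩

theorem isTrajectory_openAt (hk : 1 ≤ k) (hU : WellOrderedClocks U) :
    IsTrajectory k U (openAt k U) := by
  intro t e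
  rw [mem_openAt, and_comm, mem_everOpen_iff hU]
  refine and_congr_right fun _ => ?_
  constructor
  · intro h s hs v hv
    exact (forall_openDegree_openAt_lt_iff hk v).2 (h v hv) s hs
  · intro h v hv
    exact (forall_openDegree_openAt_lt_iff hk v).1 fun s hs => h s hs v hv

theorem IsTrajectory.eq (hU : WellOrderedClocks U) {ω ω' : I → Set (Edge d)}
    (h : IsTrajectory k U ω) (h' : IsTrajectory k U ω') : ω = ω' := by
  have key : ∀ e t, e ∈ ω t ↔ e ∈ ω' t := by
    intro e
    induction e using hU.induction with
    | _ e ih =>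
      intro t
      rw [h t e, h' t e]
      refine and_congr_right fun _ => forall₂_congr fun s hs => forall₂_congr fun v hv => ?_
      rw [openDegree_congr_at fun f hf => ?_]
      by_cases hfe : U f < U e
      · exact ih f ⟨⟨v, hf, hv⟩, hfe⟩ s
      · exact iff_of_false (fun hf' => hfe (((h s f).1 hf').1.trans_lt hs))
          fun hf' => hfe (((h' s f).1 hf').1.trans_lt hs)
  ext t e
  exact key e t

theorem existsUnique_isTrajectory (hk : 1 ≤ k) (hU : WellOrderedClocks U) :
    ∃! ω, IsTrajectory k U ω :=
  ⟨_, isTrajectory_openAt hk hU, fun _ h => h.eq hU (isTrajectory_openAt hk hU)⟩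

/-- The last edge to open at `v` found fewer than `k` open edges there. Injectivity is essential:
edges ringing simultaneously would not see each other. -/
theorem openDegree_openAt_le (hU : WellOrderedClocks U) (hinj : Function.Injective U) (t : I)
    (v : Fin d → ℤ) : openDegree (openAt k U t) v ≤ k := by
  classical
  set T := (edgesAt v).filter fun f => f ∈ openAt k U t with hT
  rcases T.eq_empty_or_nonempty with hempty | hne
  · rw [openDegree_congr_at (ζ := ∅), openDegree_empty]
    · exact zero_le
    · intro f hf
      refine iff_of_false (fun hf' => ?_) (Set.notMem_empty _)
      have : f ∈ T := by simpa [hT, hf] using hf'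
      simp [hempty] at this
  · obtain ⟨g, hg, hmax⟩ := T.exists_max_image U hne
    have hg' : v ∈ (g : Sym2 (Fin d → ℤ)) ∧ g ∈ openAt k U t := by
      simpa [hT] using hg
    have h1 := (mem_everOpen_iff hU).1 hg'.2.1 v hg'.1
    have h2 : openDegree (openAt k U t) v ≤
        openDegree (insert g {f ∈ everOpen k U | U f < U g}) v := by
      refine openDegree_mono_at fun f hf hf' => ?_
      rcases (hmax f (by simpa [hT, hf] using hf')).lt_or_eq with hlt | heq
      · exact Or.inr ⟨hf'.1, hlt⟩
      · exact Or.inl (hinj heq)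
    exact h2.trans ((openDegree_insert_le _ _).trans (Order.add_one_le_of_lt h1))

/-- Finite modifications: closing the edges of `F` and then opening those of `A ⊆ F` just before
time `t` is achieved by changing the clocks of `F` and of the closed edges touching `F`. -/
theorem openAt_eq_of_modify (hU : WellOrderedClocks U) (hU' : WellOrderedClocks U') {s t : I}
    {A F H : Finset (Edge d)} (hAF : A ⊆ F) (hFH : F ⊆ H)
    (hdeg : ∀ v, openDegree ((openAt k U t \ F) ∪ A) v ≤ k)
    (hclosed : ∀ e ∈ H, e ∉ F → e ∉ openAt k U t)
    (hnear : ∀ e ∈ F, ∀ f, Touch f e → f ∉ H → f ∈ openAt k U t ∧ U f ≤ s)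
    (hout : ∀ e ∉ H, U' e = U e) (hA : ∀ e ∈ A, s < U' e ∧ U' e ≤ t)
    (hHA : ∀ e ∈ H, e ∉ A → t < U' e) :
    openAt k U' t = (openAt k U t \ F) ∪ A := by
  have hAH : A ⊆ H := hAF.trans hFH
  have hmemH : ∀ e ∈ H, U' e ≤ t → e ∈ A := fun e he het => by
    by_contra h
    exact absurd (hHA e he h) (not_lt.2 het)
  have key : ∀ e, U' e ≤ t → (e ∈ everOpen k U' ↔ e ∈ (openAt k U t \ F) ∪ A) := by
    intro e
    induction e using hU'.induction with
    | _ e ih =>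
      intro het
      rw [mem_everOpen_iff hU']
      have ih' : ∀ v ∈ (e : Sym2 (Fin d → ℤ)), ∀ f : Edge d, v ∈ (f : Sym2 (Fin d → ℤ)) →
          U' f < U' e → (f ∈ everOpen k U' ↔ f ∈ (openAt k U t \ F) ∪ A) :=
        fun v hv f hf hfe => ih f ⟨⟨v, hf, hv⟩, hfe⟩ (hfe.le.trans het)
      -- An edge of `A` finds at each end only edges of the target configuration, and not itself,
      -- hence fewer than `k`.
      by_cases heA : e ∈ A
      · refine iff_of_true (fun v hv => lt_of_lt_of_le ?_ (hdeg v)) (Or.inr heA)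
        exact openDegree_lt_of_ssubset hv (fun f hf hf' => (ih' v hv f hf hf'.2).1 hf'.1)
          (Or.inr heA) fun h => lt_irrefl _ h.2
      have heH : e ∉ H := fun h => heA (hmemH e h het)
      have heF : e ∉ F := fun h => heH (hFH h)
      rw [hout e heH] at het
      have hmem : e ∈ (openAt k U t \ F) ∪ A ↔ e ∈ everOpen k U := by
        simp [heA, heF, mem_openAt, het]
      rw [hmem]
      -- An edge outside `H` touching `F` was open and rang by time `s`, before any edge of `A`. It
      -- meets no more open edges than it did originally, so it still opens.
      by_cases hadj : ∃ g ∈ F, Touch e g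
      · obtain ⟨g, hg, hge⟩ := hadj
        obtain ⟨heo, hes⟩ := hnear g hg e hge heH
        refine iff_of_true (fun v hv => ?_) heo.1
        refine lt_of_le_of_lt (openDegree_mono_at fun f hf hf' => ?_)
          ((mem_everOpen_iff hU).1 heo.1 v hv)
        have hfe := hf'.2
        have h1 := (ih' v hv f hf hfe).1 hf'.1
        rw [hout e heH] at hfe
        have hfA : f ∉ A := fun h => absurd (hfe.le.trans hes) (not_le.2 (hA f h).1)
        have hfH : f ∉ H := fun h => hfA (hmemH f h (hfe.le.trans het))
        rw [hout f hfH] at hfe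
        rcases h1 with h1 | h1
        · exact ⟨h1.1.1, hfe⟩
        · exact absurd h1 hfA
      -- Away from `F` nothing visible changes: a touching edge in `H` was closed, and with its new
      -- clock past `t` it still contributes nothing before `e` rings.
      · rw [mem_everOpen_iff hU]
        refine forall₂_congr fun v hv => ?_
        rw [openDegree_congr_at fun f hf => ?_]
        have hfF : f ∉ F := fun h => hadj ⟨f, h, v, hv, hf⟩
        have hfA : f ∉ A := fun h => hfF (hAF h)
        by_cases hfH : f ∈ H
        · refine iff_of_false (fun h => ?_) fun h => hclosed f hfH hfF ⟨h.1, h.2.le.trans het⟩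
          have h2 := h.2
          rw [hout e heH] at h2
          exact hfA (hmemH f hfH (h2.le.trans het))
        · have h1 := hout f hfH
          have h2 := hout e heH
          constructor
          · intro h
            have := (ih' v hv f hf h.2).1 h.1
            rw [Set.mem_union, or_iff_left (by exact hfA)] at this
            exact ⟨this.1.1, by rw [← h1, ← h2]; exact h.2⟩
          · intro h
            have h3 : U' f < U' e := by rw [h1, h2]; exact h.2
            exact ⟨(ih' v hv f hf h3).2 (Or.inl ⟨⟨h.1, h.2.le.trans het⟩, hfF⟩), h3⟩
  ext e
  rw [mem_openAt]
  constructor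
  · rintro ⟨h1, h2⟩
    exact (key e h2).1 h1
  · intro h
    have : U' e ≤ t := by
      rcases h with h | h
      · have : e ∉ H := fun he => hclosed e he h.2 h.1
        rw [hout e this]
        exact h.1.2
      · exact (hA e h).2
    exact ⟨(key e this).2 h, this⟩

end Dynamics

/-! ### Almost sure properties of the clocks, and finite energy -/

section Clocks

variable {d : ℕ}

instance : IsProbabilityMeasure (clockLaw d) := by unfold clockLaw; infer_instance

open scoped Classical in
/-- The chains of `n + 1` consecutively touching edges started at a given edge. -/
noncomputable def chainsFrom : ℕ → Edge d → Finset (List (Edge d))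
  | 0, e => {[e]}
  | n + 1, e => (nearEdges e).biUnion fun f => (chainsFrom n f).image (List.cons e)

theorem card_chainsFrom_le (n : ℕ) (e : Edge d) :
    (chainsFrom n e).card ≤ (2 * (unitSteps d).card) ^ n := by
  classical
  induction n generalizing e with
  | zero => simp [chainsFrom]
  | succ n ih =>
    rw [chainsFrom]
    refine Finset.card_biUnion_le.trans ((Finset.sum_le_card_nsmul _ _ _ fun f _ =>
      Finset.card_image_le.trans (ih f)).trans ?_)
    rw [smul_eq_mul, pow_succ']
    exact Nat.mul_le_mul_right _ (card_nearEdges_le e)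

theorem length_of_mem_chainsFrom {n : ℕ} {e : Edge d} {l : List (Edge d)}
    (h : l ∈ chainsFrom n e) : l.length = n + 1 := by
  classical
  induction n generalizing e l with
  | zero =>
    rw [chainsFrom, Finset.mem_singleton] at h
    simp [h]
  | succ n ih =>
    rw [chainsFrom] at h
    simp only [Finset.mem_biUnion, Finset.mem_image] at h
    obtain ⟨f, _, l', hl', rfl⟩ := h
    simp [ih hl']

theorem map_range_mem_chainsFrom (c : ℕ → Edge d) (hc : ∀ n, Touch (c (n + 1)) (c n)) (n N : ℕ) :
    (List.range (n + 1)).map (fun i => c (N + i)) ∈ chainsFrom n (c N) := by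
  classical
  induction n generalizing N with
  | zero => simp [chainsFrom]
  | succ n ih =>
    rw [chainsFrom]
    simp only [Finset.mem_biUnion, Finset.mem_image]
    refine ⟨c (N + 1), mem_nearEdges.2 (hc N), _, ih (N + 1), ?_⟩
    rw [List.range_succ_eq_map (n := n + 1), List.map_cons, List.map_map]
    congr 1
    refine List.map_congr_left fun i _ => ?_
    simp only [Function.comp_apply]
    congr 1
    omega

/-- Union bound over chains. Without repetitions the `n + 1` clocks of a chain are independent. -/
theorem measure_chain_le {J : Set I} (hJ : MeasurableSet J) (n : ℕ) (e : Edge d) :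
    clockLaw d {U | ∃ l ∈ chainsFrom n e, l.Nodup ∧ ∀ f ∈ l, U f ∈ J} ≤
      (2 * (unitSteps d).card : ENNReal) ^ n * volume J ^ (n + 1) := by
  classical
  have : {U : Edge d → I | ∃ l ∈ chainsFrom n e, l.Nodup ∧ ∀ f ∈ l, U f ∈ J} ⊆
      ⋃ l ∈ (chainsFrom n e).filter List.Nodup,
        Set.pi (l.toFinset : Set (Edge d)) fun _ => J := by
    rintro U ⟨l, hl, hnd, h⟩
    simp only [Set.mem_iUnion]
    exact ⟨l, by simp [hl, hnd], fun f hf => h f (by simpa using hf)⟩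
  refine (measure_mono this).trans ((measure_biUnion_finset_le _ _).trans ?_)
  refine (Finset.sum_le_card_nsmul _ _ (volume J ^ (n + 1)) fun l hl => ?_).trans ?_
  · rw [Finset.mem_filter] at hl
    rw [clockLaw, Measure.infinitePi_pi _ fun _ _ => hJ, Finset.prod_const,
      List.toFinset_card_of_nodup hl.2, length_of_mem_chainsFrom hl.1]
  · rw [nsmul_eq_mul]
    gcongr
    have := (Finset.card_filter_le (chainsFrom n e) List.Nodup).trans (card_chainsFrom_le n e)
    exact_mod_cast this

theorem ae_exists_no_chain {J : Set I} (hJ : MeasurableSet J)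
    (hsmall : 2 * ((unitSteps d).card : ENNReal) * volume J < 1) :
    ∀ᵐ U ∂clockLaw d, ∀ e, ∃ n, ∀ l ∈ chainsFrom n e, l.Nodup → ∃ f ∈ l, U f ∉ J := by
  rw [ae_all_iff]
  intro e
  rw [ae_iff, ← nonpos_iff_eq_zero]
  refine ge_of_tendsto' (ENNReal.tendsto_pow_atTop_nhds_zero_of_lt_one hsmall) fun n => ?_
  calc _ ≤ clockLaw d {U | ∃ l ∈ chainsFrom n e, l.Nodup ∧ ∀ f ∈ l, U f ∈ J} := by
        refine measure_mono fun U hU => ?_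
        have hU : ¬ ∃ n, ∀ l ∈ chainsFrom n e, l.Nodup → ∃ f ∈ l, U f ∉ J := hU
        push Not at hU
        exact hU n
    _ ≤ _ := measure_chain_le hJ n e
    _ ≤ _ := by
        rw [pow_succ, ← mul_assoc, mul_pow _ (volume J)]
        exact mul_le_of_le_one_right' (prob_le_one (μ := (volume : Measure I)))

theorem volume_floor_le (m : ℕ) (hm : 0 < m) (j : ℕ) :
    volume {u : I | ⌊(m : ℝ) * u⌋₊ = j} ≤ ENNReal.ofReal (1 / m) := by
  rw [unitInterval.volume_apply]
  have hm' : (0 : ℝ) < m := by exact_mod_cast hm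
  refine (measure_mono (t := Set.Ico ((j : ℝ) / m) ((j + 1) / m)) ?_).trans ?_
  · rintro _ ⟨u, hu, rfl⟩
    have hu : ⌊(m : ℝ) * u⌋₊ = j := hu
    rw [Nat.floor_eq_iff (mul_nonneg hm'.le u.2.1)] at hu
    rw [Set.mem_Ico, div_le_iff₀ hm', lt_div_iff₀ hm', mul_comm]
    exact hu
  · rw [Real.volume_Ico]
    refine ENNReal.ofReal_le_ofReal (le_of_eq ?_)
    ring

/-- Cut `[0, 1]` into slabs of length `1 / m`, with `m` larger than the branching number of chains.
Inside a slab the chains are subcritical, while a decreasing chain must end up in a single slab. -/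
theorem ae_wellOrderedClocks (d : ℕ) : ∀ᵐ U ∂clockLaw d, WellOrderedClocks U := by
  obtain ⟨m, hm0, hm⟩ : ∃ m : ℕ, 0 < m ∧ 2 * (unitSteps d).card < m :=
    ⟨2 * (unitSteps d).card + 1, by omega, by omega⟩
  have h : ∀ᵐ U ∂clockLaw d, ∀ j : ℕ, ∀ e, ∃ n, ∀ l ∈ chainsFrom n e, l.Nodup →
      ∃ f ∈ l, U f ∉ {u : I | ⌊(m : ℝ) * u⌋₊ = j} := by
    rw [ae_all_iff]
    intro j
    refine ae_exists_no_chain ?_ ?_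
    · exact (Nat.measurable_floor.comp (by fun_prop : Measurable fun u : I => (m : ℝ) * u))
        (measurableSet_singleton j)
    · refine (mul_le_mul_right (volume_floor_le m hm0 j) _).trans_lt ?_
      rw [← ENNReal.ofReal_natCast, ← ENNReal.ofReal_ofNat, ← ENNReal.ofReal_mul (by norm_num),
        ← ENNReal.ofReal_mul (by positivity), ENNReal.ofReal_lt_one, mul_one_div,
        div_lt_one (by exact_mod_cast hm0)]
      exact_mod_cast hm
  filter_upwards [h] with U hU
  rw [WellOrderedClocks, wellFounded_iff_isEmpty_descending_chain]
  refine ⟨fun ⟨c, hc⟩ => ?_⟩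
  have hanti : StrictAnti fun n => U (c n) := strictAnti_nat_of_succ_lt fun n => (hc n).2
  set g : ℕ → ℕ := fun n => ⌊(m : ℝ) * U (c n)⌋₊ with hg
  -- The slab index is non-increasing along the chain, so it is constant after attaining its
  -- minimum.
  obtain ⟨N, hN⟩ : ∃ N, ∀ n, g N ≤ g n := ⟨_, fun n => Function.argmin_le g n⟩
  have hconst : ∀ i, g (N + i) = g N := fun i => by
    refine le_antisymm (Nat.floor_le_floor ?_) (hN _)
    have : U (c (N + i)) ≤ U (c N) := hanti.antitone (Nat.le_add_right _ _)
    have : (U (c (N + i)) : ℝ) ≤ U (c N) := this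
    gcongr
  obtain ⟨n, hn⟩ := hU (g N) (c N)
  obtain ⟨f, hf, hf'⟩ := hn _ (map_range_mem_chainsFrom c (fun n => (hc n).1) n N) (by
    refine List.Nodup.map (fun i j hij => ?_) List.nodup_range
    have := hanti.injective (congrArg U hij)
    omega)
  obtain ⟨i, -, rfl⟩ := List.mem_map.1 hf
  exact hf' (hconst i)

theorem ae_injective (d : ℕ) : ∀ᵐ U ∂clockLaw d, Function.Injective U := by
  have : ∀ᵐ U ∂clockLaw d, ∀ e f : Edge d, e ≠ f → U e ≠ U f := by
    rw [ae_all_iff]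
    intro e
    rw [ae_all_iff]
    intro f
    by_cases hef : e = f
    · simp [hef]
    · filter_upwards [ae_apply_ne_apply (volume : Measure I) hef] with U hU _ using hU
  filter_upwards [this] with U hU e f hef
  by_contra h
  exact hU e f h hef

theorem ae_ne (d : ℕ) (t : I) : ∀ᵐ U ∂clockLaw d, ∀ e, U e ≠ t := by
  rw [ae_all_iff]
  exact fun e => ae_apply_ne_const _ e t

/-- Finite energy: almost surely, no finite modification of the open edges that
respects the constraint leads to a null event. -/
theorem ae_modify_notMem {k : ℕ} {t : I} (ht0 : 0 < t) (ht1 : t < 1) {S : Set (Set (Edge d))}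
    (hS : ∀ᵐ U ∂clockLaw d, openAt k U t ∉ S) :
    ∀ᵐ U ∂clockLaw d, ∀ A F : Finset (Edge d), A ⊆ F →
      (∀ v, openDegree ((openAt k U t \ F) ∪ A) v ≤ k) → (openAt k U t \ F) ∪ A ∉ S := by
  classical
  -- A sequence of times increasing to `t` leaves only countably many choices of `(A, F, H, n)` to
  -- exclude.
  obtain ⟨u, -, hut, hulim⟩ := exists_seq_strictMono_tendsto' ht0
  have main : ∀ᵐ U ∂clockLaw d, ∀ (A F H : Finset (Edge d)) (n : ℕ), ¬ (A ⊆ F ∧ F ⊆ H ∧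
      (∀ v, openDegree ((openAt k U t \ F) ∪ A) v ≤ k) ∧
      (∀ e ∈ H, e ∉ F → e ∉ openAt k U t) ∧
      (∀ e ∈ F, ∀ f, Touch f e → f ∉ H → f ∈ openAt k U t ∧ U f ≤ u n) ∧
      WellOrderedClocks U ∧ (openAt k U t \ F) ∪ A ∈ S) := by
    simp only [ae_all_iff]
    intro A F H n
    by_contra hpos
    rw [ae_iff] at hpos
    simp only [not_not] at hpos
    set B := {U : Edge d → I | A ⊆ F ∧ F ⊆ H ∧
      (∀ v, openDegree ((openAt k U t \ F) ∪ A) v ≤ k) ∧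
      (∀ e ∈ H, e ∉ F → e ∉ openAt k U t) ∧
      (∀ e ∈ F, ∀ f, Touch f e → f ∉ H → f ∈ openAt k U t ∧ U f ≤ u n) ∧
      WellOrderedClocks U ∧ (openAt k U t \ F) ∪ A ∈ S} with hB
    set R : Set (Edge d → I) :=
      Set.pi (H : Set (Edge d)) fun e => if e ∈ A then Set.Ioc (u n) t else Set.Ioi t with hR
    have hRpos : clockLaw d R ≠ 0 := by
      rw [hR, clockLaw, Measure.infinitePi_pi _ fun e _ => by
        split_ifs
        exacts [measurableSet_Ioc, measurableSet_Ioi]]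
      rw [Finset.prod_ne_zero_iff]
      intro e _
      split_ifs
      · rw [unitInterval.volume_Ioc, ne_eq, ENNReal.ofReal_eq_zero, not_le, sub_pos]
        exact (hut n).2
      · rw [unitInterval.volume_Ioi, ne_eq, ENNReal.ofReal_eq_zero, not_le, sub_pos]
        exact ht1
    have hmp : MeasurePreserving (fun p : (Edge d → I) × (Edge d → I) => H.piecewise p.2 p.1)
      ((clockLaw d).prod (clockLaw d)) (clockLaw d) := measurePreserving_piecewise volume H
    have hgood : ∀ᵐ U ∂clockLaw d, WellOrderedClocks U ∧ openAt k U t ∉ S :=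
      (ae_wellOrderedClocks d).and hS
    have hgood' := hmp.quasiMeasurePreserving.ae hgood
    rw [ae_iff] at hgood'
    have hsub : B ×ˢ R ⊆ {p : (Edge d → I) × (Edge d → I) |
        ¬ (WellOrderedClocks (H.piecewise p.2 p.1) ∧ openAt k (H.piecewise p.2 p.1) t ∉ S)} := by
      rintro ⟨U, V⟩ ⟨⟨hAF, hFH, hdeg, hcl, hnear, hU, hmem⟩, hV⟩ ⟨hU', hnot⟩
      refine hnot ?_
      rw [openAt_eq_of_modify hU hU' hAF hFH hdeg hcl hnear]
      · exact hmem
      · intro e he; simp [he]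
      · intro e he
        have := hV e (hFH (hAF he))
        simpa [he, hFH (hAF he)] using this
      · intro e he heA
        have := hV e he
        simpa [he, heA] using this
    have := measure_mono_null hsub hgood'
    -- `B` need not be measurable, since `S` is arbitrary; the product formula for rectangles holds
    -- for all sets.
    rw [Measure.prod_prod, mul_eq_zero] at this
    exact this.elim hpos hRpos
  filter_upwards [main, ae_wellOrderedClocks d, ae_ne d t] with U hmain hU hne A F hAF hdeg hmem
  set G : Finset (Edge d) := F.biUnion nearEdges with hG
  set H : Finset (Edge d) := F ∪ G.filter fun e => e ∉ openAt k U t with hH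
  -- Finitely many open edges touch `F`, and none rings exactly at `t`, so some `u n` bounds all
  -- their clocks.
  have hn : ∃ n, ∀ f ∈ G.filter fun e => e ∈ openAt k U t, U f ≤ u n := by
    have : ∀ᶠ n in Filter.atTop, ∀ f ∈ G.filter fun e => e ∈ openAt k U t, U f ≤ u n := by
      rw [Filter.eventually_all_finset]
      intro f hf
      have hlt : U f < t := lt_of_le_of_ne (Finset.mem_filter.1 hf).2.2 (hne f)
      filter_upwards [hulim.eventually (lt_mem_nhds hlt)] with n hn using hn.le
    exact this.exists
  obtain ⟨n, hn⟩ := hn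
  refine hmain A F H n ⟨hAF, Finset.subset_union_left, hdeg, fun e he heF => ?_,
    fun e he f hfe hfH => ?_, hU, hmem⟩
  · rw [hH, Finset.mem_union, Finset.mem_filter] at he
    exact (he.resolve_left heF).2
  · have hfG : f ∈ G := Finset.mem_biUnion.2 ⟨e, he, mem_nearEdges.2 hfe⟩
    have hfo : f ∈ openAt k U t := by
      by_contra h
      exact hfH (Finset.mem_union_right _ (Finset.mem_filter.2 ⟨hfG, h⟩))
    exact ⟨hfo, hn f (Finset.mem_filter.2 ⟨hfG, hfo⟩)⟩

end Clocks

/-! ### Clusters, trifurcations and endpoints in a general graph -/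

section Graph

variable {V : Type*} {G G' : SimpleGraph V}

/-- The connected component of a vertex, as a set. -/
def cluster (G : SimpleGraph V) (x : V) : Set V := {y | G.Reachable x y}

theorem mem_cluster {x y : V} : y ∈ cluster G x ↔ G.Reachable x y := Iff.rfl

theorem mem_cluster_self (x : V) : x ∈ cluster G x := SimpleGraph.Reachable.refl x

theorem cluster_mono (h : G ≤ G') (x : V) : cluster G x ⊆ cluster G' x :=
  fun _ hy => SimpleGraph.Reachable.mono h hy

theorem cluster_eq_of_reachable {x y : V} (h : G.Reachable x y) : cluster G x = cluster G y := by
  ext z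
  exact ⟨fun hz => h.symm.trans hz, fun hz => h.trans hz⟩

/-- Remove all edges touching a set of vertices. -/
def cut (G : SimpleGraph V) (S : Set V) : SimpleGraph V where
  Adj x y := G.Adj x y ∧ x ∉ S ∧ y ∉ S
  symm := ⟨fun _ _ h => ⟨h.1.symm, h.2.2, h.2.1⟩⟩
  loopless := ⟨fun _ h => G.irrefl h.1⟩

theorem cut_adj {S : Set V} {x y : V} : (cut G S).Adj x y ↔ G.Adj x y ∧ x ∉ S ∧ y ∉ S := Iff.rfl

theorem cut_le (S : Set V) : cut G S ≤ G := fun _ _ h => h.1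

/-- Three distinct infinite components, given by representatives. -/
def ThreeInfinite (G : SimpleGraph V) (a b c : V) : Prop :=
  ((cluster G a).Infinite ∧ (cluster G b).Infinite ∧ (cluster G c).Infinite) ∧
    ¬ G.Reachable a b ∧ ¬ G.Reachable b c ∧ ¬ G.Reachable a c

/-- Two distinct infinite components, given by representatives. -/
def TwoInfinite (G : SimpleGraph V) (a b : V) : Prop :=
  ((cluster G a).Infinite ∧ (cluster G b).Infinite) ∧ ¬ G.Reachable a b

/-- A trifurcation: a vertex whose removal leaves at least three infinite components next to it. -/
def IsTrifurcation (G : SimpleGraph V) (z : V) : Prop :=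
  ∃ a b c, (G.Adj z a ∧ G.Adj z b ∧ G.Adj z c) ∧ ThreeInfinite (cut G {z}) a b c

/-- A vertex of degree at most one in an infinite component. -/
def IsEndpoint (G : SimpleGraph V) (x : V) : Prop :=
  (cluster G x).Infinite ∧ ∀ y z, G.Adj x y → G.Adj x z → y = z

theorem reachable_induction {x : V} {p : V → Prop} (h0 : p x)
    (hstep : ∀ y z, G.Reachable x y → p y → G.Adj y z → p z) {y : V} (h : G.Reachable x y) :
    p y := by
  rw [SimpleGraph.reachable_iff_reflTransGen] at h
  induction h with
  | refl => exact h0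
  | tail h1 h2 ih =>
    exact hstep _ _ ((SimpleGraph.reachable_iff_reflTransGen _ _).2 h1) ih h2

section Comap

variable (e : V ≃ V)

theorem reachable_comap_equiv {x y : V} :
    (G.comap e).Reachable x y ↔ G.Reachable (e x) (e y) :=
  (SimpleGraph.Iso.comap e G).reachable_iff.symm

theorem infinite_cluster_comap_equiv {x : V} :
    (cluster (G.comap e) x).Infinite ↔ (cluster G (e x)).Infinite := by
  have : cluster (G.comap e) x = e ⁻¹' cluster G (e x) := by
    ext y; exact reachable_comap_equiv e
  rw [this, ← not_iff_not, Set.not_infinite, Set.not_infinite]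
  exact ⟨fun h => h.of_preimage e.surjective, fun h => h.preimage e.injective.injOn⟩

theorem threeInfinite_comap_equiv {a b c : V} :
    ThreeInfinite (G.comap e) a b c ↔ ThreeInfinite G (e a) (e b) (e c) := by
  simp only [ThreeInfinite, reachable_comap_equiv, infinite_cluster_comap_equiv]

theorem twoInfinite_comap_equiv {a b : V} :
    TwoInfinite (G.comap e) a b ↔ TwoInfinite G (e a) (e b) := by
  simp only [TwoInfinite, reachable_comap_equiv, infinite_cluster_comap_equiv]

theorem cut_comap_equiv (z : V) : cut (G.comap e) {z} = (cut G {e z}).comap e := by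
  ext x y
  simp [cut_adj]

theorem isTrifurcation_comap_equiv {z : V} :
    IsTrifurcation (G.comap e) z ↔ IsTrifurcation G (e z) := by
  simp only [IsTrifurcation, cut_comap_equiv, threeInfinite_comap_equiv, SimpleGraph.comap_adj]
  constructor
  · rintro ⟨a, b, c, h⟩
    exact ⟨_, _, _, h⟩
  · rintro ⟨a, b, c, h⟩
    refine ⟨e.symm a, e.symm b, e.symm c, ?_⟩
    simpa using h

theorem isEndpoint_comap_equiv {x : V} : IsEndpoint (G.comap e) x ↔ IsEndpoint G (e x) := by
  simp only [IsEndpoint, infinite_cluster_comap_equiv, SimpleGraph.comap_adj]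
  refine and_congr_right fun _ => ⟨fun h y z => ?_, fun h y z hy hz => e.injective (h _ _ hy hz)⟩
  simpa using h (e.symm y) (e.symm z)

end Comap

section Measurability

variable {Ω : Type*} [MeasurableSpace Ω] [Countable V] {Γ : Ω → SimpleGraph V}

theorem measurable_reachable (hΓ : ∀ x y, Measurable fun ω => (Γ ω).Adj x y) (x y : V) :
    Measurable fun ω => (Γ ω).Reachable x y := by
  have hn : ∀ n : ℕ, ∀ x, Measurable fun ω => ∃ p : (Γ ω).Walk x y, p.length = n := by
    intro n
    induction n with
    | zero =>
      intro x
      have : (fun ω => ∃ p : (Γ ω).Walk x y, p.length = 0) = fun _ => x = y := by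
        ext ω
        exact ⟨fun ⟨p, hp⟩ => SimpleGraph.Walk.eq_of_length_eq_zero hp,
          fun h => by subst h; exact ⟨.nil, rfl⟩⟩
      rw [this]
      exact measurable_const
    | succ n ih =>
      intro x
      have : (fun ω => ∃ p : (Γ ω).Walk x y, p.length = n + 1) =
          fun ω => ∃ z, (Γ ω).Adj x z ∧ ∃ p : (Γ ω).Walk z y, p.length = n := by
        ext ω
        constructor
        · rintro ⟨p, hp⟩
          cases p with
          | nil => simp at hp
          | @cons _ z _ h q => exact ⟨z, h, q, by simpa using hp⟩
        · rintro ⟨z, h, q, hq⟩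
          exact ⟨.cons h q, by simp [hq]⟩
      rw [this]
      exact Measurable.exists fun z => (hΓ x z).and (ih z)
  have : (fun ω => (Γ ω).Reachable x y) = fun ω => ∃ n, ∃ p : (Γ ω).Walk x y, p.length = n := by
    ext ω
    exact ⟨fun ⟨p⟩ => ⟨_, p, rfl⟩, fun ⟨_, p, _⟩ => ⟨p⟩⟩
  rw [this]
  exact Measurable.exists fun n => hn n x

theorem measurable_infinite_cluster (hΓ : ∀ x y, Measurable fun ω => (Γ ω).Adj x y) (x : V) :
    Measurable fun ω => (cluster (Γ ω) x).Infinite := by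
  have : (fun ω => (cluster (Γ ω) x).Infinite) =
      fun ω => ∀ S : Finset V, ∃ y, y ∉ S ∧ (Γ ω).Reachable x y := by
    ext ω
    constructor
    · intro h S
      obtain ⟨y, hy, hyS⟩ := h.exists_notMem_finset S
      exact ⟨y, hyS, hy⟩
    · intro h hfin
      obtain ⟨y, hy, hyS⟩ := h hfin.toFinset
      exact hy (hfin.mem_toFinset.2 hyS)
  rw [this]
  exact Measurable.forall fun S => Measurable.exists fun y =>
    measurable_const.and (measurable_reachable hΓ x y)

theorem measurable_threeInfinite (hΓ : ∀ x y, Measurable fun ω => (Γ ω).Adj x y) (a b c : V) :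
    Measurable fun ω => ThreeInfinite (Γ ω) a b c :=
  ((measurable_infinite_cluster hΓ a).and ((measurable_infinite_cluster hΓ b).and
    (measurable_infinite_cluster hΓ c))).and ((measurable_reachable hΓ a b).not.and
    ((measurable_reachable hΓ b c).not.and (measurable_reachable hΓ a c).not))

theorem measurable_twoInfinite (hΓ : ∀ x y, Measurable fun ω => (Γ ω).Adj x y) (a b : V) :
    Measurable fun ω => TwoInfinite (Γ ω) a b :=
  ((measurable_infinite_cluster hΓ a).and (measurable_infinite_cluster hΓ b)).and
    (measurable_reachable hΓ a b).not

theorem measurable_isTrifurcation (hΓ : ∀ x y, Measurable fun ω => (Γ ω).Adj x y) (z : V) :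
    Measurable fun ω => IsTrifurcation (Γ ω) z :=
  Measurable.exists fun a => Measurable.exists fun b => Measurable.exists fun c =>
    ((hΓ z a).and ((hΓ z b).and (hΓ z c))).and
      (measurable_threeInfinite (fun x y => (hΓ x y).and measurable_const) a b c)

theorem measurable_isEndpoint (hΓ : ∀ x y, Measurable fun ω => (Γ ω).Adj x y) (x : V) :
    Measurable fun ω => IsEndpoint (Γ ω) x :=
  (measurable_infinite_cluster hΓ x).and (Measurable.forall fun y => Measurable.forall fun z =>
    (hΓ x y).imp ((hΓ x z).imp measurable_const))

end Measurability

/-! ### Deterministic counting of trifurcations and endpoints -/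

section Cut

/-- A vertex whose component meets `S` is either in `S` or connected off `S` to a neighbour
of `S`. -/
theorem exists_adj_of_reachable {S : Set V} {x s : V} (h : G.Reachable x s) (hs : s ∈ S)
    (hx : x ∉ S) : ∃ y, y ∉ S ∧ (∃ u ∈ S, G.Adj y u) ∧ (cut G S).Reachable x y := by
  obtain ⟨p⟩ := h
  induction p with
  | nil => exact absurd hs hx
  | @cons u v w huv p ih =>
    by_cases hv : v ∈ S
    · exact ⟨u, hx, ⟨v, hv, huv⟩, .refl _⟩
    · obtain ⟨y, hy, hyS, hvy⟩ := ih hs hv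
      have : (cut G S).Adj u v := ⟨huv, hx, hv⟩
      exact ⟨y, hy, hyS, this.reachable.trans hvy⟩

/-- An infinite component meeting a finite set `S` contains an infinite component
off `S` next to `S`. -/
theorem exists_infinite_cluster_cut {S : Set V} (hS : S.Finite)
    (hfin : ∀ v, (G.neighborSet v).Finite) {x : V} (hx : x ∈ S) (hinf : (cluster G x).Infinite) :
    ∃ y, y ∉ S ∧ (∃ u ∈ S, G.Adj y u) ∧ G.Reachable x y ∧ (cluster (cut G S) y).Infinite := by
  by_contra hcon
  push Not at hcon
  refine hinf (Set.Finite.subset (hS.union (Set.Finite.biUnion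
    (s := {y | y ∉ S ∧ (∃ u ∈ S, G.Adj y u) ∧ G.Reachable x y})
    (t := fun y => cluster (cut G S) y) ?_ ?_)) ?_)
  · refine (hS.biUnion fun v _ => hfin v).subset ?_
    rintro y ⟨_, ⟨u, hu, huy⟩, _⟩
    exact Set.mem_biUnion hu huy.symm
  · rintro y ⟨hy, ⟨u, hu, hyu⟩, hxy⟩
    exact hcon y hy ⟨u, hu, hyu⟩ hxy
  · intro w hw
    by_cases hwS : w ∈ S
    · exact Or.inl hwS
    · obtain ⟨y, hy, hyS, hwy⟩ := exists_adj_of_reachable hw.symm hx hwS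
      exact Or.inr (Set.mem_biUnion (x := y) ⟨hy, hyS, hw.trans (hwy.mono (cut_le S))⟩ hwy.symm)

theorem eq_of_reachable_cut {S : Set V} {x y : V} (hx : x ∈ S) (h : (cut G S).Reachable x y) :
    y = x :=
  reachable_induction (p := fun y => y = x) rfl
    (fun u v _ h (hadj : (cut G S).Adj u v) => absurd (h ▸ hx) hadj.2.1) h

/-- A connected set of vertices: every set meeting it and closed inside it under adjacency
contains it. -/
def ConnectedIn (G : SimpleGraph V) (D : Set V) : Prop :=
  ∀ S : Set V, (∃ x ∈ D, x ∈ S) → (∀ u ∈ D, u ∈ S → ∀ v ∈ D, G.Adj u v → v ∈ S) → D ⊆ S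

theorem connectedIn_cluster (h : G' ≤ G) (x : V) : ConnectedIn G (cluster G' x) := by
  rintro S ⟨a, ha, haS⟩ hS y hy
  have : G'.Reachable a y := (mem_cluster.1 ha).symm.trans hy
  exact reachable_induction (p := fun y => y ∈ S) haS (fun u v hau hu huv =>
    hS u ((mem_cluster.1 ha).trans hau) hu v ((mem_cluster.1 ha).trans
      (hau.trans huv.reachable)) (h huv)) this

/-- Otherwise `D ∩ W` would be nonempty and closed under adjacency in `D`, forcing the infinite `D`
into the finite `W`. -/
theorem ConnectedIn.exists_mem_sdiff {D W W' : Set V} (hD : ConnectedIn G D) (hinf : D.Infinite)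
    (hW : W.Finite) (hWW' : ∀ u ∈ W, ∀ v, G.Adj u v → v ∈ W') {a : V} (haD : a ∈ D)
    (ha : a ∈ W') : ∃ b ∈ D, b ∈ W' ∧ b ∉ W := by
  by_contra hcon
  push Not at hcon
  exact hinf (hW.subset (hD W ⟨a, haD, hcon a haD ha⟩ fun u _ hu v hv huv =>
    hcon v hv (hWW' u hu v huv)))

theorem card_le_of_pairwiseDisjoint {𝓕 : Finset (Set V)} (hdisj : (𝓕 : Set (Set V)).PairwiseDisjoint id)
    {B : Finset V} (h : ∀ D ∈ 𝓕, ∃ b ∈ D, b ∈ B) : 𝓕.card ≤ B.card := by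
  rcases 𝓕.eq_empty_or_nonempty with rfl | ⟨D, hD⟩
  · simp
  have : Nonempty V := ⟨(h D hD).choose⟩
  choose! f hf hfB using h
  refine Finset.card_le_card_of_injOn f hfB fun D hD D' hD' heq => ?_
  by_contra hne
  exact Set.disjoint_left.1 (hdisj hD hD' hne) (hf D hD) (heq ▸ hf D' hD')

theorem reachable_cut_of_not_reachable_cut {z w x u : V} (h : (cut G {z}).Reachable x u)
    (hw : ¬ (cut G {z}).Reachable x w) : (cut G {w}).Reachable x u := by
  refine reachable_induction (p := fun u => (cut G {w}).Reachable x u) (.refl _)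
    (fun a b hxa ih (hab : (cut G {z}).Adj a b) => ih.trans (SimpleGraph.Adj.reachable ⟨hab.1, ?_, ?_⟩)) h
  · rintro rfl
    exact hw hxa
  · rintro rfl
    exact hw (hxa.trans hab.reachable)

/-- Among finitely many trifurcations, one has two infinite branches free of the others. -/
theorem exists_leaf_trifurcation {T : Finset V} (hT : T.Nonempty)
    (h : ∀ z ∈ T, IsTrifurcation G z) :
    ∃ z ∈ T, ∃ a b, (G.Adj z a ∧ G.Adj z b) ∧
      ((cluster (cut G {z}) a).Infinite ∧ (cluster (cut G {z}) b).Infinite) ∧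
      ¬ (cut G {z}).Reachable a b ∧
      (∀ w ∈ T, w ∉ cluster (cut G {z}) a ∧ w ∉ cluster (cut G {z}) b) := by
  classical
  set N : V × V → ℕ := fun p => (T.filter fun w => w ∈ cluster (cut G {p.1}) p.2).card with hN
  -- Extremal choice: the branch, at a site of `T`, containing the most sites of `T`.
  obtain ⟨⟨z, x⟩, ⟨hz, hzx⟩, hmax⟩ : ∃ p : V × V, (p.1 ∈ T ∧ G.Adj p.1 p.2) ∧
      ∀ q : V × V, q.1 ∈ T ∧ G.Adj q.1 q.2 → N q ≤ N p := by
    have hbdd : ∀ q : V × V, N q ≤ T.card := fun q => Finset.card_filter_le _ _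
    have hne : ∃ p : V × V, p.1 ∈ T ∧ G.Adj p.1 p.2 := by
      obtain ⟨z, hz⟩ := hT
      obtain ⟨a, -, -, ⟨ha, -⟩, -⟩ := h z hz
      exact ⟨(z, a), hz, ha⟩
    obtain ⟨p, hp, hmin⟩ := WellFounded.has_min (measure fun q : V × V => T.card - N q).wf
      {q | q.1 ∈ T ∧ G.Adj q.1 q.2} hne
    refine ⟨p, hp, fun q hq => ?_⟩
    have h1 : ¬ (T.card - N q < T.card - N p) := hmin q hq
    have := hbdd q
    have := hbdd p
    omega
  -- If another branch at `z` contained some `w ∈ T`, the branch at `w` towards `z` would contain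
  -- `z` and the whole branch of `x`, beating the maximum.
  have hfree : ∀ y, G.Adj z y → ¬ (cut G {z}).Reachable x y →
      ∀ w ∈ T, w ∉ cluster (cut G {z}) y := by
    intro y hzy hxy w hw hwy
    have hwz : w ≠ z := by
      rintro rfl
      exact hzy.ne (eq_of_reachable_cut (Set.mem_singleton _) (mem_cluster.1 hwy).symm).symm
    have hzw : G.Reachable z w := hzy.reachable.trans ((mem_cluster.1 hwy).mono (cut_le _))
    obtain ⟨x', hx'w, ⟨u, hu, hadj⟩, hzx'⟩ :=
      exists_adj_of_reachable hzw (Set.mem_singleton w) (fun h => hwz (Set.mem_singleton_iff.1 h).symm)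
    rw [Set.mem_singleton_iff] at hu
    subst hu
    have hxw : ¬ (cut G {z}).Reachable x u := fun h =>
      hxy (h.trans (mem_cluster.1 hwy).symm)
    have hzx2 : (cut G {u}).Adj z x := by
      refine ⟨hzx, fun h => hwz (Set.mem_singleton_iff.1 h).symm, fun h => hxw ?_⟩
      rw [Set.mem_singleton_iff.1 h]
    have hlt : N (z, x) < N (u, x') := by
      refine Finset.card_lt_card (Finset.ssubset_iff_of_subset ?_ |>.2 ⟨z, ?_, ?_⟩)
      · intro v hv
        rw [Finset.mem_filter] at hv ⊢
        exact ⟨hv.1, (hzx'.symm.trans hzx2.reachable).trans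
          (reachable_cut_of_not_reachable_cut hv.2 hxw)⟩
      · exact Finset.mem_filter.2 ⟨hz, hzx'.symm⟩
      · intro hmem
        exact hzx.ne (eq_of_reachable_cut (Set.mem_singleton _)
          (mem_cluster.1 (Finset.mem_filter.1 hmem).2).symm).symm
    exact absurd (hmax (u, x') ⟨hw, hadj.symm⟩) (not_le.2 hlt)
  obtain ⟨a, b, c, ⟨ha, hb, hc⟩, ⟨hai, hbi, hci⟩, hab, hbc, hac⟩ := h z hz
  have hpair : ∀ a b, G.Adj z a → G.Adj z b → (cluster (cut G {z}) a).Infinite →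
      (cluster (cut G {z}) b).Infinite → ¬ (cut G {z}).Reachable a b →
      ¬ (cut G {z}).Reachable x a → ¬ (cut G {z}).Reachable x b →
      ∃ z ∈ T, ∃ a b, (G.Adj z a ∧ G.Adj z b) ∧
      ((cluster (cut G {z}) a).Infinite ∧ (cluster (cut G {z}) b).Infinite) ∧
      ¬ (cut G {z}).Reachable a b ∧
      (∀ w ∈ T, w ∉ cluster (cut G {z}) a ∧ w ∉ cluster (cut G {z}) b) :=
    fun a b ha hb hai hbi hab hxa hxb => ⟨z, hz, a, b, ⟨ha, hb⟩, ⟨hai, hbi⟩, hab,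
      fun w hw => ⟨hfree a ha hxa w hw, hfree b hb hxb w hw⟩⟩
  -- At most one of the three infinite branches is that of `x`; the other two are free.
  by_cases hxa : (cut G {z}).Reachable x a
  · exact hpair b c hb hc hbi hci hbc (fun h => hab (hxa.symm.trans h))
      fun h => hac (hxa.symm.trans h)
  by_cases hxb : (cut G {z}).Reachable x b
  · exact hpair a c ha hc hai hci hac hxa fun h => hbc (hxb.symm.trans h)
  · exact hpair a b ha hb hai hbi hab hxa hxb

/-- Restoring a leaf trifurcation `z` to `T` loses at most one set of the family, the one containing
`z`, and gains the two free branches: a net gain of at least one. -/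
theorem exists_disjoint_family_of_isTrifurcation (T : Finset V) (h : ∀ z ∈ T, IsTrifurcation G z) :
    ∃ 𝓕 : Finset (Set V), T.card ≤ 𝓕.card ∧ (𝓕 : Set (Set V)).PairwiseDisjoint id ∧
      ∀ D ∈ 𝓕, (D.Infinite ∧ ConnectedIn G D) ∧ (∀ z ∈ T, z ∉ D) ∧ ∃ z ∈ T, ∃ x ∈ D, G.Adj z x := by
  classical
  induction hn : T.card generalizing T with
  | zero => exact ⟨∅, le_rfl, by simp, by simp⟩
  | succ n ih =>
    obtain ⟨z, hz, a, b, ⟨hza, hzb⟩, ⟨hai, hbi⟩, hab, hfree⟩ :=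
      exists_leaf_trifurcation (Finset.card_pos.1 (by omega)) h
    obtain ⟨𝓕, hcard, hdisj, hprop⟩ := ih (T.erase z) (fun w hw => h w (Finset.mem_of_mem_erase hw))
      (by rw [Finset.card_erase_of_mem hz]; omega)
    have hleaf : ∀ c, (∀ w ∈ T, w ∉ cluster (cut G {z}) c) → ∀ D ∈ 𝓕, z ∉ D →
        Disjoint D (cluster (cut G {z}) c) := by
      intro c hc D hD hzD
      rw [Set.disjoint_left]
      intro y hyD hyc
      obtain ⟨⟨-, hconn⟩, -, t, ht, x, hxD, htx⟩ := hprop D hD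
      -- A connected set avoiding `z` and meeting the branch lies inside it; then so does the site
      -- of `T` adjacent to it, contrary to freeness.
      have hsub : D ⊆ cluster (cut G {z}) c := by
        refine hconn _ ⟨y, hyD, hyc⟩ fun u hu huc v hv huv => (mem_cluster.1 huc).trans
          (SimpleGraph.Adj.reachable ⟨huv, ?_, ?_⟩)
        · rintro rfl
          exact hzD hu
        · rintro rfl
          exact hzD hv
      have hxz : x ∉ ({z} : Set V) := by
        rintro rfl
        exact hzD hxD
      have hadj : (cut G {z}).Adj x t := ⟨htx.symm, hxz, fun h => Finset.ne_of_mem_erase ht h⟩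
      exact hc t (Finset.mem_of_mem_erase ht) ((mem_cluster.1 (hsub hxD)).trans hadj.reachable)
    set A := cluster (cut G {z}) a with hA
    set B := cluster (cut G {z}) b with hB
    have hAB : Disjoint A B := by
      rw [Set.disjoint_left]
      intro y hyA hyB
      exact hab ((mem_cluster.1 hyA).trans (mem_cluster.1 hyB).symm)
    set 𝓔 := 𝓕.filter fun D => z ∉ D with h𝓔
    have hAE : ∀ D ∈ 𝓔, Disjoint D A := fun D hD =>
      hleaf a (fun w hw => (hfree w hw).1) D (Finset.mem_filter.1 hD).1 (Finset.mem_filter.1 hD).2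
    have hBE : ∀ D ∈ 𝓔, Disjoint D B := fun D hD =>
      hleaf b (fun w hw => (hfree w hw).2) D (Finset.mem_filter.1 hD).1 (Finset.mem_filter.1 hD).2
    have hAne : A ∉ 𝓔 := fun h => Set.disjoint_left.1 (hAE A h) (mem_cluster_self a) (mem_cluster_self a)
    have hBne : B ∉ 𝓔 := fun h => Set.disjoint_left.1 (hBE B h) (mem_cluster_self b) (mem_cluster_self b)
    have hABne : A ≠ B := fun h => Set.disjoint_left.1 hAB (mem_cluster_self a) (h ▸ mem_cluster_self a)
    refine ⟨insert A (insert B 𝓔), ?_, ?_, ?_⟩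
    · rw [Finset.card_insert_of_notMem (by simp [hABne, hAne]), Finset.card_insert_of_notMem hBne]
      have h1 : (𝓕.filter fun D => z ∈ D).card ≤ 1 := by
        rw [Finset.card_le_one]
        intro D hD D' hD'
        rw [Finset.mem_filter] at hD hD'
        by_contra hne
        exact Set.disjoint_left.1 (hdisj hD.1 hD'.1 hne) hD.2 hD'.2
      have h2 : (𝓕.filter fun D => z ∈ D).card + 𝓔.card = 𝓕.card := by
        rw [h𝓔]
        convert Finset.card_filter_add_card_filter_not (s := 𝓕) fun D => z ∈ D
      omega
    · rw [Finset.coe_insert, Finset.coe_insert]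
      refine Set.PairwiseDisjoint.insert (Set.PairwiseDisjoint.insert
        (hdisj.subset fun D hD => (Finset.mem_filter.1 hD).1) ?_) ?_
      · exact fun D hD _ => (hBE D hD).symm
      · rintro D (rfl | hD) _
        · exact hAB
        · exact (hAE D hD).symm
    · intro D hD
      rw [Finset.mem_insert, Finset.mem_insert] at hD
      rcases hD with rfl | rfl | hD
      · exact ⟨⟨hai, connectedIn_cluster (cut_le _) a⟩, fun w hw => (hfree w hw).1, z, hz, a,
          mem_cluster_self a, hza⟩
      · exact ⟨⟨hbi, connectedIn_cluster (cut_le _) b⟩, fun w hw => (hfree w hw).2, z, hz, b,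
          mem_cluster_self b, hzb⟩
      · obtain ⟨hD, hzD⟩ := Finset.mem_filter.1 hD
        obtain ⟨h1, h2, t, ht, x, hx, htx⟩ := hprop D hD
        refine ⟨h1, fun w hw => ?_, t, Finset.mem_of_mem_erase ht, x, hx, htx⟩
        by_cases hwz : w = z
        · exact hwz ▸ hzD
        · exact h2 w (Finset.mem_erase.2 ⟨hwz, hw⟩)

/-- Burton–Keane: trifurcations in a finite set are at most as many as the sites of a surrounding
shell. -/
theorem card_trifurcation_le {W W' T : Finset V} (hTW : T ⊆ W)
    (hWW' : ∀ u ∈ W, ∀ v, G.Adj u v → v ∈ W') (h : ∀ z ∈ T, IsTrifurcation G z) [DecidableEq V] :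
    T.card ≤ (W' \ W).card := by
  obtain ⟨𝓕, hcard, hdisj, hprop⟩ := exists_disjoint_family_of_isTrifurcation T h
  refine hcard.trans (card_le_of_pairwiseDisjoint hdisj fun D hD => ?_)
  obtain ⟨⟨hinf, hconn⟩, -, t, ht, x, hx, htx⟩ := hprop D hD
  obtain ⟨b, hb, hbW', hbW⟩ := hconn.exists_mem_sdiff (W := W) (W' := W') hinf W.finite_toSet
    hWW' hx (hWW' t (hTW ht) x htx)
  exact ⟨b, hb, Finset.mem_sdiff.2 ⟨hbW', hbW⟩⟩

/-- In a graph of degrees at most two, the interior of a path to a vertex of degree one is closed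
under adjacency. -/
theorem mem_support_of_adj (hdeg : ∀ v a b c, G.Adj v a → G.Adj v b → G.Adj v c → a = b ∨ b = c ∨ a = c)
    {x y : V} (p : G.Walk x y) (hp : p.IsPath) (hy : ∀ a b, G.Adj y a → G.Adj y b → a = b)
    {v w : V} (hv : v ∈ p.support) (hvx : v ≠ x) (hvw : G.Adj v w) : w ∈ p.support := by
  induction p with
  | nil => simp at hv; exact absurd hv hvx
  | @cons u u' y' h q ih =>
    rw [SimpleGraph.Walk.cons_isPath_iff] at hp
    rw [SimpleGraph.Walk.support_cons, List.mem_cons] at hv ⊢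
    have hvq := hv.resolve_left hvx
    by_cases hvu' : v = u'
    · subst hvu'
      cases q with
      | nil => exact Or.inl (hy _ _ hvw h.symm)
      | @cons _ u'' _ h' q' =>
        rcases hdeg v u u'' w h.symm h' hvw with h1 | h1 | h1
        · exact absurd (by simp [h1]) hp.2
        · right; simp [← h1]
        · exact Or.inl h1.symm
    · exact Or.inr (ih hp.1 hy hvq hvu')

/-- With degrees at most two, a path between distinct endpoints is closed under adjacency, so it
would exhaust the cluster and make it finite. -/
theorem eq_of_reachable_of_isEndpoint
    (hdeg : ∀ v a b c, G.Adj v a → G.Adj v b → G.Adj v c → a = b ∨ b = c ∨ a = c)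
    {x y : V} (hx : IsEndpoint G x) (hy : IsEndpoint G y) (h : G.Reachable x y) : x = y := by
  classical
  obtain ⟨p, hp⟩ := h.exists_isPath
  by_contra hxy
  refine hx.1 ((List.finite_toSet p.support).subset fun z hz => ?_)
  refine reachable_induction (p := fun z => z ∈ p.support) p.start_mem_support
    (fun v w _ hv hvw => ?_) hz
  by_cases hvx : v = x
  · subst hvx
    cases p with
    | nil => exact absurd rfl hxy
    | cons h' q =>
      rw [hx.2 w _ hvw h']
      simp
  · exact mem_support_of_adj hdeg p hp hy.2 hv hvx hvw

/-- Distinct endpoints have disjoint infinite clusters, and each cluster must cross the shell. -/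
theorem card_endpoint_le
    (hdeg : ∀ v a b c, G.Adj v a → G.Adj v b → G.Adj v c → a = b ∨ b = c ∨ a = c)
    {W W' T : Finset V} (hTW : T ⊆ W) (hWW : W ⊆ W')
    (hWW' : ∀ u ∈ W, ∀ v, G.Adj u v → v ∈ W') (h : ∀ z ∈ T, IsEndpoint G z) [DecidableEq V] :
    T.card ≤ (W' \ W).card := by
  classical
  have hinj : Set.InjOn (cluster G) T := fun x hx y hy hxy =>
    eq_of_reachable_of_isEndpoint hdeg (h x hx) (h y hy) (by
      have : y ∈ cluster G x := hxy ▸ mem_cluster_self y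
      exact this)
  rw [← Finset.card_image_of_injOn hinj]
  refine card_le_of_pairwiseDisjoint ?_ fun D hD => ?_
  · rintro D hD D' hD' hne
    obtain ⟨x, hx, rfl⟩ := Finset.mem_image.1 hD
    obtain ⟨y, hy, rfl⟩ := Finset.mem_image.1 hD'
    refine Set.disjoint_left.2 fun z hz hz' => hne ?_
    exact cluster_eq_of_reachable ((mem_cluster.1 hz).trans (mem_cluster.1 hz').symm)
  · obtain ⟨x, hx, rfl⟩ := Finset.mem_image.1 hD
    obtain ⟨b, hb, hbW', hbW⟩ := (connectedIn_cluster le_rfl x).exists_mem_sdiff (W := W) (W' := W')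
      (h x hx).1 W.finite_toSet hWW' (mem_cluster_self x) (hWW (hTW hx))
    exact ⟨b, hb, Finset.mem_sdiff.2 ⟨hbW', hbW⟩⟩

end Cut

end Graph

/-! ### Translation invariance, measurability, and density arguments -/

section Stationarity

variable {d k : ℕ} {t : I}

theorem stage_comp_shiftEdge (a : Fin d → ℤ) (U : Edge d → I) (n : ℕ) :
    stage k (U ∘ shiftEdge a) n = shiftEdge a ⁻¹' stage k U n := by
  induction n with
  | zero => rfl
  | succ n ih =>
    ext e
    change (∀ v ∈ (e : Sym2 (Fin d → ℤ)),
        openDegree {f ∈ stage k (U ∘ shiftEdge a) n | U (shiftEdge a f) < U (shiftEdge a e)} v < k) ↔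
      ∀ v ∈ (shiftEdge a e : Sym2 (Fin d → ℤ)),
        openDegree {f ∈ stage k U n | U f < U (shiftEdge a e)} v < k
    have hset : {f ∈ stage k (U ∘ shiftEdge a) n | U (shiftEdge a f) < U (shiftEdge a e)} =
        shiftEdge a ⁻¹' {f ∈ stage k U n | U f < U (shiftEdge a e)} := by
      rw [ih]; rfl
    rw [hset]
    simp only [openDegree_preimage_shiftEdge]
    constructor
    · intro h v hv
      have hv' : v - a + a ∈ (shiftEdge a e : Sym2 (Fin d → ℤ)) := by simpa using hv
      simpa using h (v - a) (mem_shiftEdge.1 hv')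
    · exact fun h v hv => h _ (mem_shiftEdge.2 hv)

theorem openAt_comp_shiftEdge (a : Fin d → ℤ) (U : Edge d → I) :
    openAt k (U ∘ shiftEdge a) t = shiftEdge a ⁻¹' openAt k U t := by
  ext e
  simp only [openAt, everOpen, stage_comp_shiftEdge]
  rfl

/-- Failure of the bound means having some `k`-element set of open neighbours, a countable union
over finite sets. -/
theorem measurable_openDegree_lt {Ω : Type*} [MeasurableSpace Ω] {X : Ω → Set (Edge d)}
    (hX : ∀ e, Measurable fun ω => e ∈ X ω) (v : Fin d → ℤ) :
    Measurable fun ω => openDegree (X ω) v < k := by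
  have : (fun ω => openDegree (X ω) v < k) =
      fun ω => ¬ ∃ T : Finset (Fin d → ℤ), T.card = k ∧ ∀ y ∈ T, ∃ h, mkEdge (x := v) (y := y) h ∈ X ω := by
    ext ω
    rw [← not_le, not_iff_not, openDegree]
    constructor
    · intro h
      obtain ⟨T, hT, hTk⟩ := Set.exists_subset_encard_eq h
      have hfin : T.Finite := Set.finite_of_encard_eq_coe hTk
      refine ⟨hfin.toFinset, ?_, fun y hy => hT (hfin.mem_toFinset.1 hy)⟩
      rw [hfin.encard_eq_coe_toFinset_card] at hTk
      exact_mod_cast hTk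
    · rintro ⟨T, hT, h⟩
      rw [← hT, ← Set.encard_coe_eq_coe_finsetCard]
      exact Set.encard_le_encard fun y hy => h y hy
  rw [this]
  refine (Measurable.exists fun T => measurable_const.and <| Measurable.forall fun y =>
    Measurable.imp measurable_const ?_).not
  by_cases h : (lattice d).Adj v y
  · simpa [h] using hX (mkEdge h)
  · simp [h]

theorem measurable_openGraph_adj {Ω : Type*} [MeasurableSpace Ω] {X : Ω → Set (Edge d)}
    (hX : ∀ e, Measurable fun ω => e ∈ X ω) (x y : Fin d → ℤ) :
    Measurable fun ω => (openGraph (X ω)).Adj x y := by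
  by_cases h : (lattice d).Adj x y
  · simpa [openGraph_adj, h] using hX (mkEdge h)
  · simp [openGraph_adj, h]

theorem measurable_lt_clock (f e : Edge d) : Measurable fun U : Edge d → I => U f < U e :=
  measurableSet_setOfPred.1 (measurableSet_lt (measurable_pi_apply f) (measurable_pi_apply e))

theorem measurable_mem_stage (n : ℕ) (e : Edge d) :
    Measurable fun U : Edge d → I => e ∈ stage k U n := by
  induction n generalizing e with
  | zero => exact measurable_const
  | succ n ih =>
    exact Measurable.forall fun v => Measurable.imp measurable_const
      (measurable_openDegree_lt (fun f => (ih f).and (measurable_lt_clock f e)) v)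

theorem measurable_mem_openAt (e : Edge d) : Measurable fun U : Edge d → I => e ∈ openAt k U t := by
  have : (fun U : Edge d → I => e ∈ openAt k U t) =
      fun U => (∃ N, ∀ n, N ≤ n → e ∈ stage k U n) ∧ U e ≤ t := by
    ext U
    simp [openAt, everOpen]
  rw [this]
  refine (Measurable.exists fun N => Measurable.forall fun n => Measurable.imp measurable_const
    (measurable_mem_stage n e)).and ?_
  exact measurableSet_setOfPred.1 (measurableSet_le (measurable_pi_apply e) measurable_const)

/-- The open graph at time `t`. -/
abbrev graphAt (k : ℕ) (t : I) (U : Edge d → I) : SimpleGraph (Fin d → ℤ) := openGraph (openAt k U t)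

theorem measurable_graphAt_adj (x y : Fin d → ℤ) :
    Measurable fun U : Edge d → I => (graphAt k t U).Adj x y :=
  measurable_openGraph_adj measurable_mem_openAt x y

theorem graphAt_comp_shiftEdge (a : Fin d → ℤ) (U : Edge d → I) :
    graphAt k t (U ∘ shiftEdge a) = (graphAt k t U).comap (shift a) := by
  rw [graphAt, openAt_comp_shiftEdge, openGraph_preimage_shiftEdge]

theorem measurePreserving_comp_shiftEdge (a : Fin d → ℤ) :
    MeasurePreserving (fun U : Edge d → I => U ∘ shiftEdge a) (clockLaw d) (clockLaw d) :=
  measurePreserving_comp_equiv volume (shiftEdge a)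

/-- A centered box. -/
noncomputable def box (d n : ℕ) : Finset (Fin d → ℤ) :=
  Finset.Icc (fun _ => -(n : ℤ)) (fun _ => (n : ℤ))

theorem mem_box {n : ℕ} {x : Fin d → ℤ} : x ∈ box d n ↔ ∀ i, |x i| ≤ n := by
  simp only [box, Finset.mem_Icc, Pi.le_def, abs_le, forall_and]

theorem card_box (d n : ℕ) : (box d n).card = (2 * n + 1) ^ d := by
  rw [box, Pi.card_Icc]
  simp only [Int.card_Icc, Finset.prod_const, Finset.card_univ, Fintype.card_fin]
  congr 1
  omega

theorem box_subset (d n : ℕ) : box d n ⊆ box d (n + 1) := fun x hx =>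
  mem_box.2 fun i => (mem_box.1 hx i).trans (by simp)

theorem mem_box_of_adj {n : ℕ} {x y : Fin d → ℤ} (hx : x ∈ box d n) (h : (lattice d).Adj x y) :
    y ∈ box d (n + 1) := by
  refine mem_box.2 fun i => ?_
  have h1 := mem_box.1 hx i
  have h2 := lattice_adj_abs_le h i
  rw [abs_le] at *
  push_cast
  omega

/-- A stationary random set of sites whose number in any box is at most the size of the
boundary of the box is almost surely empty. -/
theorem ae_forall_not_of_card_le {p : SimpleGraph (Fin d → ℤ) → (Fin d → ℤ) → Prop}
    (hmeas : ∀ z, Measurable fun U : Edge d → I => p (graphAt k t U) z)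
    (hcomap : ∀ a G z, p (G.comap (shift a)) z ↔ p G (z + a))
    (hcard : ∀ᵐ U ∂clockLaw d, ∀ n, ∀ T ⊆ box d n, (∀ z ∈ T, p (graphAt k t U) z) →
      T.card ≤ (box d (n + 1) \ box d n).card) :
    ∀ᵐ U ∂clockLaw d, ∀ z, ¬ p (graphAt k t U) z := by
  classical
  set E : (Fin d → ℤ) → Set (Edge d → I) := fun z => {U | p (graphAt k t U) z} with hE
  have hEm : ∀ z, MeasurableSet (E z) := fun z => measurableSet_setOfPred.2 (hmeas z)
  have hEq : ∀ z, clockLaw d (E z) = clockLaw d (E 0) := by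
    intro z
    rw [← (measurePreserving_comp_shiftEdge z).measure_preimage (hEm 0).nullMeasurableSet]
    congr 1
    ext U
    simp only [hE, Set.mem_preimage, Set.mem_ofPred_eq, graphAt_comp_shiftEdge, hcomap, zero_add]
  have hbound : ∀ n : ℕ, (box d n).card * clockLaw d (E 0) ≤ (box d (n + 1) \ box d n).card := by
    intro n
    calc (box d n).card * clockLaw d (E 0) = ∑ z ∈ box d n, clockLaw d (E z) := by
          simp [hEq]
      _ = ∫⁻ U, ∑ z ∈ box d n, (E z).indicator 1 U ∂clockLaw d := by
          rw [lintegral_finsetSum _ fun z _ => measurable_one.indicator (hEm z)]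
          simp [lintegral_indicator_one (hEm _)]
      _ ≤ ∫⁻ _, (box d (n + 1) \ box d n).card ∂clockLaw d := by
          refine lintegral_mono_ae ?_
          filter_upwards [hcard] with U hU
          have := hU n ((box d n).filter fun z => U ∈ E z) (Finset.filter_subset _ _)
            fun z hz => (Finset.mem_filter.1 hz).2
          simp only [Set.indicator_apply, Pi.one_apply, Finset.sum_boole]
          exact_mod_cast this
      _ = _ := by simp
  -- The bound is the ratio of shell to box, `((2n + 3)^d - (2n + 1)^d) / (2n + 1)^d`.
  have hreal : ∀ n : ℕ, (clockLaw d).real (E 0) ≤ (1 + 2 / (2 * (n : ℝ) + 1)) ^ d - 1 := by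
    intro n
    have h1 := ENNReal.toReal_mono (by simp) (hbound n)
    rw [ENNReal.toReal_mul, ENNReal.toReal_natCast, ENNReal.toReal_natCast,
      Finset.card_sdiff_of_subset (box_subset d n),
      Nat.cast_sub (Finset.card_le_card (box_subset d n)), card_box, card_box] at h1
    have hpos : (0 : ℝ) < 2 * n + 1 := by positivity
    have h2 : (1 + 2 / (2 * (n : ℝ) + 1)) = (2 * (n + 1) + 1) / (2 * n + 1) := by
      field_simp; ring
    rw [h2, div_pow, ← sub_nonneg, div_sub_one (by positivity), sub_nonneg, le_div_iff₀ (by positivity),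
      mul_comm]
    push_cast at h1
    exact h1
  have hlim : Filter.Tendsto (fun n : ℕ => (1 + 2 / (2 * (n : ℝ) + 1)) ^ d - 1) Filter.atTop (nhds 0) := by
    have h1 : Filter.Tendsto (fun n : ℕ => 2 / (2 * (n : ℝ) + 1)) Filter.atTop (nhds 0) := by
      refine Filter.Tendsto.const_div_atTop ?_ _
      exact Filter.tendsto_atTop_add_const_right _ _
        (tendsto_natCast_atTop_atTop.const_mul_atTop (by norm_num))
    have h2 := ((h1.const_add 1).pow d).sub_const 1
    simpa using h2
  have h0 : (clockLaw d).real (E 0) = 0 :=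
    le_antisymm (ge_of_tendsto' hlim hreal) measureReal_nonneg
  rw [measureReal_eq_zero_iff] at h0
  rw [ae_all_iff]
  intro z
  rw [ae_iff]
  simp only [not_not]
  exact (hEq z).trans h0

theorem ae_forall_not_isTrifurcation :
    ∀ᵐ U ∂clockLaw d, ∀ z, ¬ IsTrifurcation (graphAt k t U) z :=
  ae_forall_not_of_card_le (measurable_isTrifurcation measurable_graphAt_adj)
    (fun a _ _ => isTrifurcation_comap_equiv (shift a).toEquiv)
    (Filter.Eventually.of_forall fun _ _ _ hT h => card_trifurcation_le hT
      (fun _ hu _ huv => mem_box_of_adj hu (openGraph_le_lattice _ huv)) h)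

theorem eq_of_adj_of_openDegree_le_two {η : Set (Edge d)} (h : ∀ v, openDegree η v ≤ 2)
    (v a b c : Fin d → ℤ) (ha : (openGraph η).Adj v a) (hb : (openGraph η).Adj v b)
    (hc : (openGraph η).Adj v c) : a = b ∨ b = c ∨ a = c := by
  by_contra hcon
  push Not at hcon
  have h3 : ({a, b, c} : Set (Fin d → ℤ)).encard = 3 :=
    Set.encard_eq_three.2 ⟨a, b, c, hcon.1, hcon.2.2, hcon.2.1, rfl⟩
  have hsub : ({a, b, c} : Set (Fin d → ℤ)) ⊆ (openGraph η).neighborSet v := by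
    rintro x (rfl | rfl | rfl)
    exacts [ha, hb, hc]
  have := (Set.encard_le_encard hsub).trans (h v)
  rw [h3] at this
  exact absurd this (by decide)

theorem ae_openDegree_le (d k : ℕ) (t : I) :
    ∀ᵐ U ∂clockLaw d, ∀ v, openDegree (openAt k U t) v ≤ k := by
  filter_upwards [ae_wellOrderedClocks d, ae_injective d] with U h1 h2
  exact openDegree_openAt_le h1 h2 t

theorem ae_forall_not_isEndpoint (hk : k ≤ 2) :
    ∀ᵐ U ∂clockLaw d, ∀ z, ¬ IsEndpoint (graphAt k t U) z := by
  refine ae_forall_not_of_card_le (measurable_isEndpoint measurable_graphAt_adj)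
    (fun a _ _ => isEndpoint_comap_equiv (shift a).toEquiv) ?_
  filter_upwards [ae_openDegree_le d k t] with U hU n T hT h
  exact card_endpoint_le (eq_of_adj_of_openDegree_le_two fun v => (hU v).trans (by exact_mod_cast hk))
    hT (box_subset d n) (fun _ hu _ huv => mem_box_of_adj hu (openGraph_le_lattice _ huv)) h

/-- The event that there are at least two infinite components is trivial. -/
theorem ae_forall_not_twoInfinite_or_ae_exists (hd : 0 < d) :
    (∀ᵐ U ∂clockLaw d, ¬ ∃ a b, TwoInfinite (graphAt k t U) a b) ∨
      ∀ᵐ U ∂clockLaw d, ∃ a b, TwoInfinite (graphAt k t U) a b := by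
  have hm : MeasurableSet {U : Edge d → I | ∃ a b, TwoInfinite (graphAt k t U) a b} :=
    measurableSet_setOfPred.2 (Measurable.exists fun a => Measurable.exists fun b =>
      measurable_twoInfinite measurable_graphAt_adj a b)
  have h01 : clockLaw d {U : Edge d → I | ∃ a b, TwoInfinite (graphAt k t U) a b} = 0 ∨
      clockLaw d {U : Edge d → I | ∃ a b, TwoInfinite (graphAt k t U) a b} = 1 := by
    refine measure_eq_zero_or_one_of_invariant (volume : Measure I) hm fun H => ?_
    obtain ⟨a, ha⟩ := exists_shift_disjoint hd H
    refine ⟨shiftEdge a, ha, Filter.EventuallyEq.of_eq ?_⟩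
    ext U
    change (∃ x y, TwoInfinite (graphAt k t (U ∘ shiftEdge a)) x y) ↔
      ∃ x y, TwoInfinite (graphAt k t U) x y
    rw [graphAt_comp_shiftEdge]
    have := fun x y => twoInfinite_comap_equiv (G := graphAt k t U) (shift a).toEquiv (a := x) (b := y)
    constructor
    · rintro ⟨x, y, h⟩
      exact ⟨_, _, (this x y).1 h⟩
    · rintro ⟨x, y, h⟩
      refine ⟨(shift a).toEquiv.symm x, (shift a).toEquiv.symm y, (this _ _).2 ?_⟩
      rwa [Equiv.apply_symm_apply, Equiv.apply_symm_apply]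
  rcases h01 with h | h
  · left
    rw [ae_iff]
    simpa using h
  · right
    exact (mem_ae_iff_prob_eq_one hm).2 h

end Stationarity

/-! ### Opening arms through a cleared region -/

section Modification

variable {d k : ℕ} {η ξ : Set (Edge d)}

theorem openGraph_sdiff_edgesTouching (η : Set (Edge d)) (Λ : Finset (Fin d → ℤ)) :
    openGraph (η \ edgesTouching Λ) = cut (openGraph η) Λ := by
  ext x y
  constructor
  · rintro ⟨h, h1, h2⟩
    refine ⟨⟨h, h1⟩, fun hx => h2 (mem_edgesTouching.2 ⟨x, hx, Sym2.mem_mk_left _ _⟩),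
      fun hy => h2 (mem_edgesTouching.2 ⟨y, hy, Sym2.mem_mk_right _ _⟩)⟩
  · rintro ⟨⟨h, h1⟩, hx, hy⟩
    refine ⟨h, h1, fun h2 => ?_⟩
    obtain ⟨v, hv, hve⟩ := mem_edgesTouching.1 h2
    rcases (mem_mkEdge h).1 hve with rfl | rfl
    exacts [hx hv, hy hv]

theorem openDegree_eq_zero_of_forall {v : Fin d → ℤ}
    (h : ∀ e : Edge d, v ∈ (e : Sym2 (Fin d → ℤ)) → e ∉ η) : openDegree η v = 0 := by
  rw [openDegree_congr_at (ζ := ∅), openDegree_empty]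
  exact fun e he => iff_of_false (h e he) (Set.notMem_empty _)

theorem notMem_of_openDegree_eq_zero {v : Fin d → ℤ} (h : openDegree η v = 0) {e : Edge d}
    (hv : v ∈ (e : Sym2 (Fin d → ℤ))) : e ∉ η := by
  intro he
  obtain ⟨y, hy, rfl⟩ := exists_eq_mkEdge hv
  rw [openDegree, Set.encard_eq_zero] at h
  exact Set.notMem_empty y (h ▸ (⟨hy, he⟩ : (openGraph η).Adj v y))

theorem openDegree_insert_of_notMem {v : Fin d → ℤ} {e : Edge d}
    (h : v ∉ (e : Sym2 (Fin d → ℤ))) : openDegree (insert e η) v = openDegree η v :=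
  openDegree_congr_at fun f hf => ⟨fun h' => h'.resolve_left (by rintro rfl; exact h hf), Or.inr⟩

theorem openDegree_union_of_notMem {v : Fin d → ℤ} {A : Set (Edge d)}
    (h : ∀ e ∈ A, v ∉ (e : Sym2 (Fin d → ℤ))) : openDegree (η ∪ A) v = openDegree η v :=
  openDegree_congr_at fun f hf => ⟨fun h' => h'.resolve_right fun hA => h f hA hf, Or.inl⟩

theorem openDegree_insert_le_of_lt {v : Fin d → ℤ} {e : Edge d} (h : openDegree η v < k) :
    openDegree (insert e η) v ≤ k :=
  (openDegree_insert_le e v).trans (Order.add_one_le_of_lt h)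

/-- Attaching an isolated site does not change the connections between the other sites. -/
theorem reachable_of_reachable_insert {u w : Fin d → ℤ} (h : (lattice d).Adj u w)
    (hw : openDegree ξ w = 0) {b c : Fin d → ℤ} (hb : b ≠ w) (hc : c ≠ w)
    (hbc : (openGraph (insert (mkEdge h) ξ)).Reachable b c) : (openGraph ξ).Reachable b c := by
  have key : (c ≠ w → (openGraph ξ).Reachable b c) ∧ (c = w → (openGraph ξ).Reachable b u) := by
    refine reachable_induction (p := fun c => (c ≠ w → (openGraph ξ).Reachable b c) ∧
      (c = w → (openGraph ξ).Reachable b u)) ⟨fun _ => .refl _, fun h => absurd h hb⟩ ?_ hbc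
    rintro y z - ⟨ih1, ih2⟩ ⟨hyz, hmem | hmem⟩
    · rcases Sym2.eq_iff.1 (congrArg Subtype.val hmem) with ⟨rfl, rfl⟩ | ⟨rfl, rfl⟩
      · exact ⟨fun h => absurd rfl h, fun _ => ih1 hyz.ne⟩
      · exact ⟨fun _ => ih2 rfl, fun h => absurd h hyz.symm.ne⟩
    · have hy : y ≠ w := by
        rintro rfl
        exact notMem_of_openDegree_eq_zero hw (Sym2.mem_mk_left _ _) hmem
      have hz : z ≠ w := by
        rintro rfl
        exact notMem_of_openDegree_eq_zero hw (Sym2.mem_mk_right _ _) hmem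
      have hadj : (openGraph ξ).Adj y z := ⟨hyz, hmem⟩
      exact ⟨fun _ => (ih1 hy).trans hadj.reachable, fun h => absurd h hz⟩
  exact key.1 hc

/-- Opening the edges of a path from `u` towards `z` through isolated sites, up to
a neighbour of `z`. -/
theorem exists_arm (hk : 2 ≤ k) {u z : Fin d → ℤ} (p : (lattice d).Walk u z) (hp : p.IsPath)
    (huz : u ≠ z) (hdeg : ∀ v, openDegree ξ v ≤ k) (hu : openDegree ξ u < k)
    (hint : ∀ v ∈ p.support, v ≠ u → v ≠ z → openDegree ξ v = 0) :
    ∃ (a : Fin d → ℤ) (A : Finset (Edge d)), ((lattice d).Adj a z ∧ a ∈ p.support) ∧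
      openDegree (ξ ∪ A) a < k ∧ (∀ v, openDegree (ξ ∪ A) v ≤ k) ∧
      (openGraph (ξ ∪ A)).Reachable u a ∧
      (∀ e ∈ A, ∀ v ∈ (e : Sym2 (Fin d → ℤ)), (v ∈ p.support ∧ v ≠ z) ∧
        (openGraph (ξ ∪ A)).Reachable u v) ∧
      (∀ e ∈ A, ∃ v ∈ (e : Sym2 (Fin d → ℤ)), v ∈ p.support ∧ v ≠ u) ∧
      ∀ b c, (b ∈ p.support → b = u ∨ b = z) → (c ∈ p.support → c = u ∨ c = z) →
        (openGraph (ξ ∪ A)).Reachable b c → (openGraph ξ).Reachable b c := by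
  classical
  induction p generalizing ξ with
  | nil => exact absurd rfl huz
  | @cons u w z h q ih =>
    rw [SimpleGraph.Walk.cons_isPath_iff] at hp
    by_cases hwz : w = z
    · subst hwz
      refine ⟨u, ∅, ⟨h, by simp⟩, ?_⟩
      simpa using ⟨hu, hdeg⟩
    · have huw : u ≠ w := h.ne
      have hw0 : openDegree ξ w = 0 := hint w (by simp) huw.symm hwz
      -- The isolated site `w` now has degree at most 1, leaving room to continue since `2 ≤ k`.
      have hwlt : openDegree (insert (mkEdge h) ξ) w < k := by
        refine (openDegree_insert_le _ _).trans_lt ?_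
        rw [hw0, zero_add]
        exact_mod_cast hk
      have hdeg' : ∀ v, openDegree (insert (mkEdge h) ξ) v ≤ k := by
        intro v
        by_cases hvu : v = u
        · rw [hvu]
          exact openDegree_insert_le_of_lt hu
        by_cases hvw : v = w
        · rw [hvw]
          exact hwlt.le
        · rw [openDegree_insert_of_notMem (by rw [mem_mkEdge]; tauto)]
          exact hdeg v
      obtain ⟨a, A, ⟨haz, hap⟩, halt, hAdeg, hwa, hA, hA', hreach⟩ := ih hp.1 hwz hdeg' hwlt (by
        intro v hv hvw hvz
        have hvu : v ≠ u := by
          rintro rfl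
          exact hp.2 hv
        rw [openDegree_insert_of_notMem (by rw [mem_mkEdge]; tauto)]
        exact hint v (by simp [hv]) hvu hvz)
      have hset : ξ ∪ ((insert (mkEdge h) A : Finset (Edge d)) : Set (Edge d)) =
          insert (mkEdge h) ξ ∪ A := by
        rw [Finset.coe_insert, Set.union_insert, Set.insert_union]
      have hadj : (openGraph (insert (mkEdge h) ξ ∪ (A : Set (Edge d)))).Adj u w :=
        ⟨h, Or.inl (Or.inl rfl)⟩
      have hsupp : ∀ v ∈ q.support, v ∈ (SimpleGraph.Walk.cons h q).support := fun v hv => by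
        simp [hv]
      refine ⟨a, insert (mkEdge h) A, ⟨haz, hsupp a hap⟩, ?_⟩
      rw [hset]
      refine ⟨halt, hAdeg, hadj.reachable.trans hwa, ?_, ?_, ?_⟩
      · intro e he v hv
        rcases Finset.mem_insert.1 he with rfl | he
        · rcases (mem_mkEdge h).1 hv with rfl | rfl
          · exact ⟨⟨by simp, huz⟩, .refl _⟩
          · exact ⟨⟨by simp, hwz⟩, hadj.reachable⟩
        · obtain ⟨⟨h1, h2⟩, h3⟩ := hA e he v hv
          exact ⟨⟨hsupp v h1, h2⟩, hadj.reachable.trans h3⟩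
      · intro e he
        rcases Finset.mem_insert.1 he with rfl | he
        · exact ⟨w, (mem_mkEdge h).2 (Or.inr rfl), by simp, huw.symm⟩
        · obtain ⟨v, hv, hvq, -⟩ := hA' e he
          exact ⟨v, hv, hsupp v hvq, by rintro rfl; exact hp.2 hvq⟩
      -- Sites allowed for the whole path are allowed for its tail and differ from `w`, so the
      -- tail's edges can be removed first and the edge to `w` afterwards.
      · have hfree : ∀ b, (b ∈ (SimpleGraph.Walk.cons h q).support → b = u ∨ b = z) →
            (b ∈ q.support → b = w ∨ b = z) ∧ b ≠ w := by
          intro b hb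
          refine ⟨fun hbq => ?_, ?_⟩
          · rcases hb (hsupp b hbq) with rfl | rfl
            · exact absurd hbq hp.2
            · exact Or.inr rfl
          · rintro rfl
            rcases hb (by simp) with h1 | h1
            exacts [huw h1.symm, hwz h1]
        intro b c hb hc hbc
        exact reachable_of_reachable_insert h hw0 (hfree b hb).2 (hfree c hc).2
          (hreach b c (hfree b hb).1 (hfree c hc).1 hbc)

section Walks

variable {V : Type*} {G : SimpleGraph V}

theorem exists_path_to_set {S : Set V} {u s : V} (h : G.Reachable u s) (hs : s ∈ S) :
    ∃ z ∈ S, ∃ q : G.Walk u z, q.IsPath ∧ ∀ v ∈ q.support, v ∈ S → v = z := by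
  classical
  obtain ⟨p⟩ := h
  induction p with
  | nil => exact ⟨_, hs, .nil, by simp, by simp⟩
  | @cons u v w huv p ih =>
    by_cases hu : u ∈ S
    · exact ⟨u, hu, .nil, by simp, by simp⟩
    · obtain ⟨z, hz, q, -, hqS⟩ := ih hs
      refine ⟨z, hz, (SimpleGraph.Walk.cons huv q).bypass, SimpleGraph.Walk.bypass_isPath _, ?_⟩
      intro x hx hxS
      have := SimpleGraph.Walk.support_bypass_subset_support _ hx
      rw [SimpleGraph.Walk.support_cons, List.mem_cons] at this
      rcases this with rfl | hxq
      · exact absurd hxS hu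
      · exact hqS x hxq hxS

/-- Take a path from `a` to `b` and a path from `c` stopped where it first hits it; the hitting
point is the centre. -/
theorem exists_tripod {a b c : V} (hab : G.Reachable a b) (hca : G.Reachable c a) :
    ∃ (z : V) (p : G.Walk a z) (q : G.Walk b z) (r : G.Walk c z),
      (p.IsPath ∧ q.IsPath ∧ r.IsPath) ∧ (∀ v ∈ p.support, v ∈ q.support → v = z) ∧
      (∀ v ∈ p.support, v ∈ r.support → v = z) ∧ ∀ v ∈ q.support, v ∈ r.support → v = z := by
  classical
  obtain ⟨m, hm⟩ := hab.exists_isPath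
  obtain ⟨z, hz, r, hr, hrm⟩ := exists_path_to_set (S := {v | v ∈ m.support}) hca
    m.start_mem_support
  refine ⟨z, m.takeUntil z hz, (m.dropUntil z hz).reverse, r,
    ⟨hm.takeUntil hz, (hm.dropUntil hz).reverse, hr⟩, ?_, ?_, ?_⟩
  · intro v hv hv'
    rw [SimpleGraph.Walk.support_reverse, List.mem_reverse,
      SimpleGraph.Walk.mem_support_iff] at hv'
    refine hv'.resolve_right fun hv' => ?_
    have hnd := hm.support_nodup
    rw [← m.take_spec hz, SimpleGraph.Walk.support_append] at hnd
    exact (List.nodup_append.1 hnd).2.2 v hv v hv' rfl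
  · exact fun v hv hvr => hrm v hvr (m.support_takeUntil_subset_support hz hv)
  · intro v hv hvr
    rw [SimpleGraph.Walk.support_reverse, List.mem_reverse] at hv
    exact hrm v hvr (m.support_dropUntil_subset_support hz hv)

theorem mem_of_mem_support_cut_compl {S : Set V} {a b : V} (p : (cut G Sᶜ).Walk a b) (ha : a ∈ S)
    {v : V} (hv : v ∈ p.support) : v ∈ S := by
  classical
  exact reachable_induction (G := cut G Sᶜ) (p := fun v => v ∈ S) ha
    (fun x y _ _ (h : (cut G Sᶜ).Adj x y) => not_not.1 h.2.2) (p.takeUntil v hv).reachable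

/-- The support of a walk through the three points. Cutting the complement expresses connectedness
inside `Λ`. -/
theorem exists_finset_connected (hG : G.Preconnected) (a b c : V) :
    ∃ Λ : Finset V, (a ∈ Λ ∧ b ∈ Λ ∧ c ∈ Λ) ∧
      ∀ x ∈ Λ, ∀ y ∈ Λ, (cut G (Λ : Set V)ᶜ).Reachable x y := by
  classical
  obtain ⟨p⟩ := hG a b
  obtain ⟨q⟩ := hG b c
  set r := p.append q with hr
  refine ⟨r.support.toFinset, ?_, ?_⟩
  · simp [hr, SimpleGraph.Walk.mem_support_append_iff]
  · have key : ∀ {x y : V} (s : G.Walk x y) (S : Set V), (∀ v ∈ s.support, v ∈ S) →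
        ∀ v ∈ s.support, (cut G Sᶜ).Reachable x v := by
      intro x y s S
      induction s with
      | nil =>
        intro _ v hv
        rw [SimpleGraph.Walk.support_nil, List.mem_singleton] at hv
        rw [hv]
      | @cons x w y h s ih =>
        intro hS v hv
        rw [SimpleGraph.Walk.support_cons, List.mem_cons] at hv
        rcases hv with rfl | hv
        · exact .refl _
        · have hadj : (cut G Sᶜ).Adj x w :=
            ⟨h, not_not.2 (hS x (by simp)), not_not.2 (hS w (by simp))⟩
          exact hadj.reachable.trans (ih (fun v hv => hS v (by simp [hv])) v hv)
    intro x hx y hy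
    have hk := key r (r.support.toFinset : Set V) (by simp)
    exact (hk x (by simpa using hx)).symm.trans (hk y (by simpa using hy))

end Walks

/-- The situation after closing the edges touching `Λ`, seen from an infinite component that
met `Λ`. -/
theorem exists_terminal (hdeg : ∀ v, openDegree η v ≤ k) {Λ : Finset (Fin d → ℤ)} {x : Fin d → ℤ}
    (hx : x ∈ Λ) (hinf : (cluster (openGraph η) x).Infinite) :
    ∃ y u, (y ∉ Λ ∧ u ∈ Λ ∧ (lattice d).Adj y u) ∧ (openGraph η).Reachable x y ∧
      openDegree (η \ edgesTouching Λ) y < k ∧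
      (cluster (openGraph (η \ edgesTouching Λ)) y).Infinite := by
  obtain ⟨y, hy, ⟨u, hu, hadj⟩, hxy, hyinf⟩ :=
    exists_infinite_cluster_cut Λ.finite_toSet (neighborSet_finite η) hx hinf
  refine ⟨y, u, ⟨hy, hu, hadj.1⟩, hxy, ?_, ?_⟩
  -- The open edge from `y` into `Λ` has been closed, which frees a slot at `y`.
  · refine lt_of_lt_of_le (openDegree_lt_of_ssubset (e := mkEdge hadj.1) (Sym2.mem_mk_left _ _)
      (fun f _ hf => hf.1) hadj.2 fun h => h.2 ?_) (hdeg y)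
    exact mem_edgesTouching.2 ⟨u, hu, Sym2.mem_mk_right _ _⟩
  · rwa [openGraph_sdiff_edgesTouching]

theorem openDegree_sdiff_edgesTouching {Λ : Finset (Fin d → ℤ)} {v : Fin d → ℤ} (hv : v ∈ Λ) :
    openDegree (η \ edgesTouching Λ) v = 0 :=
  openDegree_eq_zero_of_forall fun _ he h => h.2 (mem_edgesTouching.2 ⟨v, hv, he⟩)

theorem openDegree_sdiff_le (hdeg : ∀ v, openDegree η v ≤ k) (F : Set (Edge d)) (v : Fin d → ℤ) :
    openDegree (η \ F) v ≤ k :=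
  (openDegree_mono_at fun _ _ h => h.1).trans (hdeg v)

end Modification

/-! ### Excluding endpoints, three infinite clusters, and two infinite clusters -/

section Uniqueness

variable {d k : ℕ} {η ξ : Set (Edge d)} {t : I}

/-- If the degrees are at most two and there is an infinite component, closing at most one edge
creates an endpoint. -/
theorem exists_modify_isEndpoint (hdeg : ∀ v, openDegree η v ≤ 2) {x : Fin d → ℤ}
    (hinf : (cluster (openGraph η) x).Infinite) :
    ∃ F : Finset (Edge d), ∃ z, IsEndpoint (openGraph (η \ F)) z := by
  classical
  have h3 := eq_of_adj_of_openDegree_le_two hdeg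
  by_cases hend : IsEndpoint (openGraph η) x
  · exact ⟨∅, x, by simpa using hend⟩
  obtain ⟨y, hxy⟩ : ∃ y, (openGraph η).Adj x y := by
    by_contra hcon
    push Not at hcon
    exact hend ⟨hinf, fun y z hy _ => absurd hy (hcon y)⟩
  set e := mkEdge hxy.1 with he
  have hadj : ∀ a b, (openGraph η).Adj a b → ¬ (a = x ∧ b = y) → ¬ (a = y ∧ b = x) →
      (openGraph (η \ ({e} : Finset (Edge d)))).Adj a b := by
    rintro a b ⟨hab, hmem⟩ h1 h2
    refine ⟨hab, hmem, fun h => ?_⟩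
    rw [Finset.coe_singleton, Set.mem_singleton_iff] at h
    rcases Sym2.eq_iff.1 (congrArg Subtype.val h) with h | h
    exacts [h1 h, h2 h]
  have hle : openGraph (η \ ({e} : Finset (Edge d))) ≤ openGraph η :=
    openGraph_mono fun _ h => h.1
  have hnot : ¬ (openGraph (η \ ({e} : Finset (Edge d)))).Adj x y := fun ⟨_, _, h⟩ =>
    h (Finset.mem_coe.2 (Finset.mem_singleton_self e))
  have hcover : cluster (openGraph η) x ⊆
      cluster (openGraph (η \ ({e} : Finset (Edge d)))) x ∪
        cluster (openGraph (η \ ({e} : Finset (Edge d)))) y := by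
    intro w hw
    refine reachable_induction (p := fun w =>
      w ∈ cluster (openGraph (η \ ({e} : Finset (Edge d)))) x ∪
        cluster (openGraph (η \ ({e} : Finset (Edge d)))) y) (Or.inl (mem_cluster_self x))
      (fun a b _ ih hab => ?_) hw
    by_cases h1 : a = x ∧ b = y
    · exact Or.inr (h1.2 ▸ mem_cluster_self _)
    by_cases h2 : a = y ∧ b = x
    · exact Or.inl (h2.2 ▸ mem_cluster_self _)
    have := (hadj a b hab h1 h2).reachable
    rcases ih with ih | ih
    · exact Or.inl (SimpleGraph.Reachable.trans ih this)
    · exact Or.inr (SimpleGraph.Reachable.trans ih this)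
  refine ⟨{e}, ?_⟩
  -- One side of the closed edge keeps an infinite cluster, and its end there has lost one of at
  -- most two edges.
  rcases Set.infinite_union.1 (hinf.mono hcover) with h | h
  · refine ⟨x, h, fun a b ha hb => ?_⟩
    rcases h3 x y a b hxy (hle ha) (hle hb) with rfl | h | rfl
    exacts [absurd ha hnot, h, absurd hb hnot]
  · refine ⟨y, h, fun a b ha hb => ?_⟩
    rcases h3 y x a b hxy.symm (hle ha) (hle hb) with rfl | h | rfl
    exacts [absurd ha.symm hnot, h, absurd hb.symm hnot]

theorem isPath_cons_mapLe {Λ : Finset (Fin d → ℤ)} {y u z : Fin d → ℤ} (h : (lattice d).Adj y u)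
    (hy : y ∉ Λ) (hu : u ∈ Λ) {p : (cut (lattice d) (Λ : Set (Fin d → ℤ))ᶜ).Walk u z}
    (hp : p.IsPath) : (SimpleGraph.Walk.cons h (p.mapLe (cut_le _))).IsPath := by
  rw [SimpleGraph.Walk.cons_isPath_iff]
  refine ⟨(SimpleGraph.Walk.isPath_mapLe _).2 hp, fun hmem => hy ?_⟩
  rw [SimpleGraph.Walk.support_mapLe_eq_support] at hmem
  exact mem_of_mem_support_cut_compl p hu hmem

/-- Joining three infinite components at an isolated site next to each of them. -/
theorem isTrifurcation_join (hk : 3 ≤ k) (hdeg : ∀ v, openDegree ξ v ≤ k)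
    {z a b c : Fin d → ℤ} (haz : (lattice d).Adj a z) (hbz : (lattice d).Adj b z)
    (hcz : (lattice d).Adj c z) (hz : openDegree ξ z = 0) (ha : openDegree ξ a < k)
    (hb : openDegree ξ b < k) (hc : openDegree ξ c < k) (h : ThreeInfinite (openGraph ξ) a b c) :
    (∀ v, openDegree (insert (mkEdge haz) (insert (mkEdge hbz) (insert (mkEdge hcz) ξ))) v ≤ k) ∧
      IsTrifurcation
        (openGraph (insert (mkEdge haz) (insert (mkEdge hbz) (insert (mkEdge hcz) ξ)))) z := by
  have hneab : a ≠ b := by rintro rfl; exact h.2.1 (.refl _)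
  have hnebc : b ≠ c := by rintro rfl; exact h.2.2.1 (.refl _)
  have hneac : a ≠ c := by rintro rfl; exact h.2.2.2 (.refl _)
  have hnot : ∀ {x v : Fin d → ℤ} (h : (lattice d).Adj x z), v ≠ z → v ≠ x →
      v ∉ (mkEdge h : Sym2 (Fin d → ℤ)) := fun h hvz hvx hv =>
    ((mem_mkEdge h).1 hv).elim hvx hvz
  refine ⟨fun v => ?_, a, b, c, ⟨?_, ?_, ?_⟩, ?_⟩
  · by_cases hvz : v = z
    · rw [hvz]
      have h1 := openDegree_insert_le (η := ξ) (mkEdge hcz) z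
      have h2 := openDegree_insert_le (η := insert (mkEdge hcz) ξ) (mkEdge hbz) z
      have h3 := openDegree_insert_le (η := insert (mkEdge hbz) (insert (mkEdge hcz) ξ))
        (mkEdge haz) z
      rw [hz, zero_add] at h1
      have h4 : (1 : ℕ∞) + 1 + 1 ≤ k := by exact_mod_cast hk
      exact h3.trans ((add_le_add (h2.trans (add_le_add h1 le_rfl)) le_rfl).trans h4)
    by_cases hva : v = a
    · rw [hva]
      refine (openDegree_insert_le _ _).trans (Order.add_one_le_of_lt ?_)
      rwa [openDegree_insert_of_notMem (hnot hbz haz.ne hneab),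
        openDegree_insert_of_notMem (hnot hcz haz.ne hneac)]
    rw [openDegree_insert_of_notMem (hnot haz hvz hva)]
    by_cases hvb : v = b
    · rw [hvb]
      refine (openDegree_insert_le _ _).trans (Order.add_one_le_of_lt ?_)
      rwa [openDegree_insert_of_notMem (hnot hcz hbz.ne hnebc)]
    rw [openDegree_insert_of_notMem (hnot hbz hvz hvb)]
    by_cases hvc : v = c
    · rw [hvc]
      exact openDegree_insert_le_of_lt hc
    rw [openDegree_insert_of_notMem (hnot hcz hvz hvc)]
    exact hdeg v
  · exact ⟨haz.symm, Or.inl (mkEdge_symm haz)⟩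
  · exact ⟨hbz.symm, Or.inr (Or.inl (mkEdge_symm hbz))⟩
  · exact ⟨hcz.symm, Or.inr (Or.inr (Or.inl (mkEdge_symm hcz)))⟩
  -- Since `z` was isolated, cutting at `z` exactly undoes the three insertions.
  · have : cut (openGraph (insert (mkEdge haz) (insert (mkEdge hbz) (insert (mkEdge hcz) ξ)))) {z} =
        openGraph ξ := by
      ext x y
      constructor
      · rintro ⟨⟨hxy, hmem⟩, hx, hy⟩
        have hne : ∀ {w : Fin d → ℤ} (hw : (lattice d).Adj w z), mkEdge hxy ≠ mkEdge hw := by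
          intro w hw heq
          have : z ∈ (mkEdge hxy : Sym2 (Fin d → ℤ)) := heq ▸ Sym2.mem_mk_right _ _
          exact ((mem_mkEdge hxy).1 this).elim (fun h => hx h.symm) fun h => hy h.symm
        exact ⟨hxy, ((hmem.resolve_left (hne haz)).resolve_left (hne hbz)).resolve_left (hne hcz)⟩
      · rintro ⟨hxy, hmem⟩
        refine ⟨⟨hxy, Or.inr (Or.inr (Or.inr hmem))⟩, ?_, ?_⟩
        · rintro rfl
          exact notMem_of_openDegree_eq_zero hz (Sym2.mem_mk_left _ _) hmem
        · rintro rfl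
          exact notMem_of_openDegree_eq_zero hz (Sym2.mem_mk_right _ _) hmem
    rwa [this]

theorem union_coe_union_insert {α : Type*} [DecidableEq α] (X : Set α) (A B C : Finset α)
    (x y z : α) : X ∪ ((A ∪ B ∪ C ∪ {x, y, z} : Finset α) : Set α) =
      insert x (insert y (insert z (X ∪ A ∪ B ∪ C))) := by
  push_cast
  simp only [Set.union_insert, Set.union_singleton, Set.union_assoc]

/-- Three infinite components can be turned into a trifurcation by a finite modification that
respects the constraint. -/
theorem exists_modify_isTrifurcation (hk : 3 ≤ k) (hdeg : ∀ v, openDegree η v ≤ k)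
    {x₁ x₂ x₃ : Fin d → ℤ} (h : ThreeInfinite (openGraph η) x₁ x₂ x₃) :
    ∃ A F : Finset (Edge d), A ⊆ F ∧ (∀ v, openDegree ((η \ F) ∪ A) v ≤ k) ∧
      ∃ z, IsTrifurcation (openGraph ((η \ F) ∪ A)) z := by
  classical
  obtain ⟨⟨h1, h2, h3⟩, h12, h23, h13⟩ := h
  obtain ⟨Λ, ⟨hx₁, hx₂, hx₃⟩, hΛ⟩ := exists_finset_connected (lattice_preconnected d) x₁ x₂ x₃
  obtain ⟨y₁, u₁, ⟨hy₁, hu₁, hyu₁⟩, hxy₁, hd₁, hi₁⟩ := exists_terminal hdeg hx₁ h1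
  obtain ⟨y₂, u₂, ⟨hy₂, hu₂, hyu₂⟩, hxy₂, hd₂, hi₂⟩ := exists_terminal hdeg hx₂ h2
  obtain ⟨y₃, u₃, ⟨hy₃, hu₃, hyu₃⟩, hxy₃, hd₃, hi₃⟩ := exists_terminal hdeg hx₃ h3
  set ξ := η \ edgesTouching Λ with hξ
  have hξη : openGraph ξ ≤ openGraph η := openGraph_mono fun _ h => h.1
  have hy12 : ¬ (openGraph ξ).Reachable y₁ y₂ := fun h =>
    h12 ((hxy₁.trans (h.mono hξη)).trans hxy₂.symm)
  have hy23 : ¬ (openGraph ξ).Reachable y₂ y₃ := fun h =>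
    h23 ((hxy₂.trans (h.mono hξη)).trans hxy₃.symm)
  have hy13 : ¬ (openGraph ξ).Reachable y₁ y₃ := fun h =>
    h13 ((hxy₁.trans (h.mono hξη)).trans hxy₃.symm)
  have hne12 : y₁ ≠ y₂ := by rintro rfl; exact hy12 (.refl _)
  have hne23 : y₂ ≠ y₃ := by rintro rfl; exact hy23 (.refl _)
  have hne13 : y₁ ≠ y₃ := by rintro rfl; exact hy13 (.refl _)
  have hξΛ : ∀ v ∈ Λ, openDegree ξ v = 0 := fun v hv => openDegree_sdiff_edgesTouching hv
  have hξdeg : ∀ v, openDegree ξ v ≤ k := openDegree_sdiff_le hdeg _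
  -- The tripod lies inside `Λ`, whose sites are all isolated in `ξ`; each leg is then lengthened by
  -- the step from its terminal `yᵢ`.
  obtain ⟨z, q₁, q₂, q₃, ⟨hq₁, hq₂, hq₃⟩, hq12, hq13, hq23⟩ :=
    exists_tripod (hΛ u₁ hu₁ u₂ hu₂) (hΛ u₃ hu₃ u₁ hu₁)
  have hzΛ : z ∈ Λ := mem_of_mem_support_cut_compl q₁ hu₁ q₁.end_mem_support
  have hqΛ₁ : ∀ v ∈ q₁.support, v ∈ Λ := fun v hv => mem_of_mem_support_cut_compl q₁ hu₁ hv
  have hqΛ₂ : ∀ v ∈ q₂.support, v ∈ Λ := fun v hv => mem_of_mem_support_cut_compl q₂ hu₂ hv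
  have hqΛ₃ : ∀ v ∈ q₃.support, v ∈ Λ := fun v hv => mem_of_mem_support_cut_compl q₃ hu₃ hv
  set p₁ := SimpleGraph.Walk.cons hyu₁ (q₁.mapLe (cut_le _)) with hp₁
  set p₂ := SimpleGraph.Walk.cons hyu₂ (q₂.mapLe (cut_le _)) with hp₂
  set p₃ := SimpleGraph.Walk.cons hyu₃ (q₃.mapLe (cut_le _)) with hp₃
  have hs₁ : ∀ v, v ∈ p₁.support ↔ v = y₁ ∨ v ∈ q₁.support := fun v => by
    rw [hp₁, SimpleGraph.Walk.support_cons, List.mem_cons,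
      SimpleGraph.Walk.support_mapLe_eq_support]
  have hs₂ : ∀ v, v ∈ p₂.support ↔ v = y₂ ∨ v ∈ q₂.support := fun v => by
    rw [hp₂, SimpleGraph.Walk.support_cons, List.mem_cons,
      SimpleGraph.Walk.support_mapLe_eq_support]
  have hs₃ : ∀ v, v ∈ p₃.support ↔ v = y₃ ∨ v ∈ q₃.support := fun v => by
    rw [hp₃, SimpleGraph.Walk.support_cons, List.mem_cons,
      SimpleGraph.Walk.support_mapLe_eq_support]
  have hnΛ : ∀ {y v}, y ∉ Λ → v ∈ Λ → v ≠ y := fun hy hv h => hy (h ▸ hv)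
  obtain ⟨a, A, ⟨haz, hap⟩, had, hAdeg, hya, hA, hA', hAr⟩ :=
    exists_arm (by omega) p₁ (isPath_cons_mapLe hyu₁ hy₁ hu₁ hq₁) (hnΛ hy₁ hzΛ).symm hξdeg hd₁
      fun v hv hvy _ => hξΛ v (hqΛ₁ v (((hs₁ v).1 hv).resolve_left hvy))
  have hAout : ∀ v, v ∉ p₁.support ∨ v = z → openDegree (ξ ∪ A) v = openDegree ξ v :=
    fun v hv => openDegree_union_of_notMem fun e he hve =>
      hv.elim (fun h => h (hA e he v hve).1.1) (hA e he v hve).1.2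
  obtain ⟨b, B, ⟨hbz, hbp⟩, hbd, hBdeg, hyb, hB, hB', hBr⟩ :=
    exists_arm (ξ := ξ ∪ A) (by omega) p₂ (isPath_cons_mapLe hyu₂ hy₂ hu₂ hq₂) (hnΛ hy₂ hzΛ).symm
      hAdeg (by
        rw [hAout y₂ (Or.inl fun h => ((hs₁ _).1 h).elim hne12.symm fun h => hy₂ (hqΛ₁ _ h))]
        exact hd₂)
      (by
        intro v hv hvy hvz
        have hv := ((hs₂ v).1 hv).resolve_left hvy
        rw [hAout v (Or.inl fun h => ((hs₁ _).1 h).elim (hnΛ hy₁ (hqΛ₂ v hv))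
          fun h => hvz (hq12 v h hv))]
        exact hξΛ v (hqΛ₂ v hv))
  have hBout : ∀ v, v ∉ p₂.support ∨ v = z →
      openDegree (ξ ∪ A ∪ B) v = openDegree (ξ ∪ A : Set (Edge d)) v :=
    fun v hv => openDegree_union_of_notMem fun e he hve =>
      hv.elim (fun h => h (hB e he v hve).1.1) (hB e he v hve).1.2
  obtain ⟨c, C, ⟨hcz, hcp⟩, hcd, hCdeg, hyc, hC, hC', hCr⟩ :=
    exists_arm (ξ := ξ ∪ A ∪ B) (by omega) p₃ (isPath_cons_mapLe hyu₃ hy₃ hu₃ hq₃)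
      (hnΛ hy₃ hzΛ).symm hBdeg (by
        rw [hBout y₃ (Or.inl fun h => ((hs₂ _).1 h).elim hne23.symm fun h => hy₃ (hqΛ₂ _ h)),
          hAout y₃ (Or.inl fun h => ((hs₁ _).1 h).elim hne13.symm fun h => hy₃ (hqΛ₁ _ h))]
        exact hd₃)
      (by
        intro v hv hvy hvz
        have hv := ((hs₃ v).1 hv).resolve_left hvy
        rw [hBout v (Or.inl fun h => ((hs₂ _).1 h).elim (hnΛ hy₂ (hqΛ₃ v hv))
          fun h => hvz (hq23 v h hv)),
          hAout v (Or.inl fun h => ((hs₁ _).1 h).elim (hnΛ hy₁ (hqΛ₃ v hv))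
          fun h => hvz (hq13 v h hv))]
        exact hξΛ v (hqΛ₃ v hv))
  have hCout : ∀ v, v ∉ p₃.support ∨ v = z →
      openDegree (ξ ∪ A ∪ B ∪ C) v = openDegree (ξ ∪ A ∪ B : Set (Edge d)) v :=
    fun v hv => openDegree_union_of_notMem fun e he hve =>
      hv.elim (fun h => h (hC e he v hve).1.1) (hC e he v hve).1.2
  set ζ := ξ ∪ A ∪ B ∪ C with hζ
  have hBζ : openGraph (ξ ∪ A ∪ B) ≤ openGraph ζ := openGraph_mono Set.subset_union_left
  have hAζ : openGraph (ξ ∪ A) ≤ openGraph ζ :=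
    (openGraph_mono Set.subset_union_left).trans hBζ
  have hξζ : openGraph ξ ≤ openGraph ζ := (openGraph_mono Set.subset_union_left).trans hAζ
  have hya : (openGraph ζ).Reachable y₁ a := hya.mono hAζ
  have hyb : (openGraph ζ).Reachable y₂ b := hyb.mono hBζ
  have hfree₁ : ∀ y, y ∉ Λ → y ∈ p₁.support → y = y₁ ∨ y = z := fun y hy h =>
    Or.inl (((hs₁ y).1 h).resolve_right fun h => hy (hqΛ₁ y h))
  have hfree₂ : ∀ y, y ∉ Λ → y ∈ p₂.support → y = y₂ ∨ y = z := fun y hy h =>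
    Or.inl (((hs₂ y).1 h).resolve_right fun h => hy (hqΛ₂ y h))
  have hfree₃ : ∀ y, y ∉ Λ → y ∈ p₃.support → y = y₃ ∨ y = z := fun y hy h =>
    Or.inl (((hs₃ y).1 h).resolve_right fun h => hy (hqΛ₃ y h))
  -- Removing the arms in reverse order shows that they create no connection between sites outside
  -- `Λ`, so the three clusters stay separate.
  have hback : ∀ x y, x ∉ Λ → y ∉ Λ → (openGraph ζ).Reachable x y → (openGraph ξ).Reachable x y :=
    fun x y hx hy h => hAr x y (hfree₁ x hx) (hfree₁ y hy) (hBr x y (hfree₂ x hx) (hfree₂ y hy)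
      (hCr x y (hfree₃ x hx) (hfree₃ y hy) h))
  have hab : ¬ (openGraph ζ).Reachable a b := fun h =>
    hy12 (hback _ _ hy₁ hy₂ ((hya.trans h).trans hyb.symm))
  have hbc : ¬ (openGraph ζ).Reachable b c := fun h =>
    hy23 (hback _ _ hy₂ hy₃ ((hyb.trans h).trans hyc.symm))
  have hac : ¬ (openGraph ζ).Reachable a c := fun h =>
    hy13 (hback _ _ hy₁ hy₃ ((hya.trans h).trans hyc.symm))
  have hinfζ : ∀ y v, (cluster (openGraph ξ) y).Infinite → (openGraph ζ).Reachable y v →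
      (cluster (openGraph ζ) v).Infinite := fun y v hy hyv => by
    rw [← cluster_eq_of_reachable hyv]
    exact hy.mono (cluster_mono hξζ y)
  have hsupp : ∀ {v : Fin d → ℤ}, v ≠ z → (v ∈ p₁.support → v ∉ p₂.support ∧ v ∉ p₃.support) ∧
      (v ∈ p₂.support → v ∉ p₃.support) := by
    intro v hvz
    simp only [hs₁, hs₂, hs₃]
    refine ⟨?_, ?_⟩
    · rintro (rfl | hv)
      · exact ⟨not_or.2 ⟨hne12, fun h => hy₁ (hqΛ₂ _ h)⟩, not_or.2 ⟨hne13, fun h => hy₁ (hqΛ₃ _ h)⟩⟩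
      · exact ⟨not_or.2 ⟨hnΛ hy₂ (hqΛ₁ v hv), fun h => hvz (hq12 v hv h)⟩,
          not_or.2 ⟨hnΛ hy₃ (hqΛ₁ v hv), fun h => hvz (hq13 v hv h)⟩⟩
    · rintro (rfl | hv)
      · exact not_or.2 ⟨hne23, fun h => hy₂ (hqΛ₃ _ h)⟩
      · exact not_or.2 ⟨hnΛ hy₃ (hqΛ₂ v hv), fun h => hvz (hq23 v hv h)⟩
  have hadζ : openDegree ζ a < k := by
    rw [hCout a (Or.inl ((hsupp haz.ne).1 hap).2), hBout a (Or.inl ((hsupp haz.ne).1 hap).1)]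
    exact had
  have hbdζ : openDegree ζ b < k := by
    rw [hCout b (Or.inl ((hsupp hbz.ne).2 hbp))]
    exact hbd
  have hz0 : openDegree ζ z = 0 := by
    rw [hCout z (Or.inr rfl), hBout z (Or.inr rfl), hAout z (Or.inr rfl)]
    exact hξΛ z hzΛ
  set Z : Finset (Edge d) := {mkEdge haz, mkEdge hbz, mkEdge hcz} with hZ
  have hset : ξ ∪ ((A ∪ B ∪ C ∪ Z : Finset (Edge d)) : Set (Edge d)) =
      insert (mkEdge haz) (insert (mkEdge hbz) (insert (mkEdge hcz) ζ)) :=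
    union_coe_union_insert ξ A B C _ _ _
  have hjoin := isTrifurcation_join hk hCdeg haz hbz hcz hz0 hadζ hbdζ hcd
    ⟨⟨hinfζ _ _ hi₁ hya, hinfζ _ _ hi₂ hyb, hinfζ _ _ hi₃ hyc⟩, hab, hbc, hac⟩
  refine ⟨A ∪ B ∪ C ∪ Z, edgesTouching Λ, ?_, ?_⟩
  · intro e he
    rw [mem_edgesTouching]
    simp only [Finset.mem_union] at he
    rcases he with ((he | he) | he) | he
    · obtain ⟨v, hv, hvp, hvy⟩ := hA' e he
      exact ⟨v, hqΛ₁ v (((hs₁ v).1 hvp).resolve_left hvy), hv⟩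
    · obtain ⟨v, hv, hvp, hvy⟩ := hB' e he
      exact ⟨v, hqΛ₂ v (((hs₂ v).1 hvp).resolve_left hvy), hv⟩
    · obtain ⟨v, hv, hvp, hvy⟩ := hC' e he
      exact ⟨v, hqΛ₃ v (((hs₃ v).1 hvp).resolve_left hvy), hv⟩
    · refine ⟨z, hzΛ, ?_⟩
      simp only [hZ, Finset.mem_insert, Finset.mem_singleton] at he
      rcases he with rfl | rfl | rfl <;> exact Sym2.mem_mk_right _ _
  rw [← hξ, hset]
  exact ⟨hjoin.1, z, hjoin.2⟩

/-- Two of the infinite components can be joined by a finite modification that respects the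
constraint, after a finite modification that closes edges. -/
theorem exists_modify_join (hk : 2 ≤ k) (hdeg : ∀ v, openDegree η v ≤ k) {x₁ x₂ : Fin d → ℤ}
    (h : TwoInfinite (openGraph η) x₁ x₂) :
    ∃ A F : Finset (Edge d), A ⊆ F ∧ (∀ v, openDegree ((η \ F) ∪ A) v ≤ k) ∧
      ((∃ a b, TwoInfinite (openGraph ((η \ F) ∪ A)) a b) →
        ∃ a b c, ThreeInfinite (openGraph (η \ F)) a b c) := by
  classical
  obtain ⟨⟨h1, h2⟩, h12⟩ := h
  -- The third point is a dummy.
  obtain ⟨Λ, ⟨hx₁, hx₂, -⟩, hΛ⟩ := exists_finset_connected (lattice_preconnected d) x₁ x₂ x₂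
  obtain ⟨y₁, u₁, ⟨hy₁, hu₁, hyu₁⟩, hxy₁, hd₁, hi₁⟩ := exists_terminal hdeg hx₁ h1
  obtain ⟨y₂, u₂, ⟨hy₂, hu₂, hyu₂⟩, hxy₂, hd₂, hi₂⟩ := exists_terminal hdeg hx₂ h2
  set ξ := η \ edgesTouching Λ with hξ
  have hy12 : ¬ (openGraph ξ).Reachable y₁ y₂ := fun h =>
    h12 ((hxy₁.trans (h.mono (openGraph_mono fun _ h => h.1))).trans hxy₂.symm)
  have hne12 : y₁ ≠ y₂ := by rintro rfl; exact hy12 (.refl _)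
  have hξΛ : ∀ v ∈ Λ, openDegree ξ v = 0 := fun v hv => openDegree_sdiff_edgesTouching hv
  obtain ⟨q, hq⟩ := (hΛ u₁ hu₁ u₂ hu₂).exists_isPath
  have hqΛ : ∀ v ∈ q.support, v ∈ Λ := fun v hv => mem_of_mem_support_cut_compl q hu₁ hv
  set r := SimpleGraph.Walk.cons hyu₁ (q.mapLe (cut_le _)) with hr
  have hrpath : r.IsPath := isPath_cons_mapLe hyu₁ hy₁ hu₁ hq
  have hsr : ∀ v, v ∈ r.support ↔ v = y₁ ∨ v ∈ q.support := fun v => by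
    rw [hr, SimpleGraph.Walk.support_cons, List.mem_cons,
      SimpleGraph.Walk.support_mapLe_eq_support]
  set p := r.concat hyu₂.symm with hp
  have hppath : p.IsPath := hrpath.concat
    (fun h => ((hsr _).1 h).elim hne12.symm fun h => hy₂ (hqΛ _ h)) _
  have hsp : ∀ v, v ∈ p.support ↔ v = y₁ ∨ v ∈ q.support ∨ v = y₂ := fun v => by
    rw [hp, SimpleGraph.Walk.support_concat, List.mem_append, hsr,
      List.mem_singleton, or_assoc]
  have hpΛ : ∀ v ∈ p.support, v ≠ y₁ → v ≠ y₂ → v ∈ Λ := fun v hv hv1 hv2 =>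
    hqΛ v ((((hsp v).1 hv).resolve_left hv1).resolve_right hv2)
  obtain ⟨a, A, ⟨hay, hap⟩, had, hAdeg, hya, hA, hA', -⟩ :=
    exists_arm hk p hppath hne12 (openDegree_sdiff_le hdeg _) hd₁
      fun v hv hv1 hv2 => hξΛ v (hpΛ v hv hv1 hv2)
  have hy₂out : openDegree (ξ ∪ A) y₂ = openDegree ξ y₂ :=
    openDegree_union_of_notMem fun e he hve => (hA e he y₂ hve).1.2 rfl
  have hset : ξ ∪ ((insert (mkEdge hay) A : Finset (Edge d)) : Set (Edge d)) =
      insert (mkEdge hay) (ξ ∪ A) := by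
    rw [Finset.coe_insert, Set.union_insert]
  have hle : openGraph (ξ ∪ A) ≤ openGraph (insert (mkEdge hay) (ξ ∪ A)) :=
    openGraph_mono (Set.subset_insert _ _)
  have hξle : openGraph ξ ≤ openGraph (insert (mkEdge hay) (ξ ∪ A)) :=
    (openGraph_mono Set.subset_union_left).trans hle
  have hadj : (openGraph (insert (mkEdge hay) (ξ ∪ A))).Adj a y₂ := ⟨hay, Or.inl rfl⟩
  have hy₁₂ : (openGraph (insert (mkEdge hay) (ξ ∪ A))).Reachable y₁ y₂ :=
    (hya.mono hle).trans hadj.reachable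
  -- `exists_arm` does not rule out `a = y₁`, when the last edge may miss `Λ`. It is therefore added
  -- to `F`, which changes nothing because it is closed in `ξ` anyway.
  have hnotξ : mkEdge hay ∉ ξ := by
    intro hmem
    by_cases hay₁ : a = y₁
    · subst hay₁
      exact hy12 (SimpleGraph.Adj.reachable ⟨hay, hmem⟩)
    · exact notMem_of_openDegree_eq_zero (hξΛ a (hpΛ a hap hay₁ hay.ne)) (Sym2.mem_mk_left _ _) hmem
  have hF : η \ ((insert (mkEdge hay) (edgesTouching Λ) : Finset (Edge d)) : Set (Edge d)) = ξ := by
    rw [Finset.coe_insert, Set.insert_eq, Set.union_comm, ← Set.sdiff_sdiff, ← hξ]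
    exact Set.sdiff_singleton_eq_self hnotξ
  refine ⟨insert (mkEdge hay) A, insert (mkEdge hay) (edgesTouching Λ), ?_, ?_⟩
  · refine Finset.insert_subset_insert _ fun e he => ?_
    obtain ⟨v, hv, hvp, hvy⟩ := hA' e he
    exact mem_edgesTouching.2 ⟨v, hpΛ v hvp hvy (hA e he v hv).1.2, hv⟩
  rw [hF, hset]
  refine ⟨fun v => ?_, ?_⟩
  · by_cases hva : v = a
    · rw [hva]
      exact openDegree_insert_le_of_lt had
    by_cases hvy : v = y₂
    · rw [hvy]
      refine openDegree_insert_le_of_lt ?_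
      rw [hy₂out]
      exact hd₂
    · rw [openDegree_insert_of_notMem (by rw [mem_mkEdge]; tauto)]
      exact hAdeg v
  · rintro ⟨w₁, w₂, ⟨hw₁, hw₂⟩, hw⟩
    -- One of the two infinite components misses `y₁`. Every added edge is connected to `y₁`, so
    -- this component was already infinite in `ξ`, alongside those of `y₁` and `y₂`.
    obtain ⟨w, hwinf, hwy⟩ : ∃ w,
        (cluster (openGraph (insert (mkEdge hay) (ξ ∪ (A : Set (Edge d))))) w).Infinite ∧
        ¬ (openGraph (insert (mkEdge hay) (ξ ∪ (A : Set (Edge d))))).Reachable y₁ w := by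
      by_cases h : (openGraph (insert (mkEdge hay) (ξ ∪ (A : Set (Edge d))))).Reachable y₁ w₁
      · exact ⟨w₂, hw₂, fun h' => hw (h.symm.trans h')⟩
      · exact ⟨w₁, hw₁, h⟩
    have hsub : cluster (openGraph (insert (mkEdge hay) (ξ ∪ (A : Set (Edge d))))) w ⊆
        cluster (openGraph ξ) w := by
      intro v hv
      refine reachable_induction (p := fun v => (openGraph ξ).Reachable w v) (.refl _)
        (fun b c hwb ih hbc => ih.trans (SimpleGraph.Adj.reachable ?_)) hv
      have hnb : ¬ (openGraph (insert (mkEdge hay) (ξ ∪ (A : Set (Edge d))))).Reachable y₁ b :=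
        fun h => hwy (h.trans hwb.symm)
      obtain ⟨hbc, hmem | hmem | hmem⟩ := hbc
      · refine absurd ?_ hnb
        have hb : b ∈ (mkEdge hay : Sym2 (Fin d → ℤ)) := hmem ▸ Sym2.mem_mk_left _ _
        rcases (mem_mkEdge hay).1 hb with rfl | rfl
        exacts [hya.mono hle, hy₁₂]
      · exact ⟨hbc, hmem⟩
      · exact absurd ((hA _ hmem b (Sym2.mem_mk_left _ _)).2.mono hle) hnb
    refine ⟨w, y₁, y₂, ⟨hwinf.mono hsub, hi₁, hi₂⟩, fun h => hwy (h.mono hξle).symm, hy12,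
      fun h => hwy (hy₁₂.trans (h.mono hξle).symm)⟩

theorem ae_not_infinite_of_le_two (ht0 : 0 < t) (ht1 : t < 1) (hk : k ≤ 2) :
    ∀ᵐ U ∂clockLaw d, ∀ x, ¬ (cluster (graphAt k t U) x).Infinite := by
  have hnull : ∀ᵐ U ∂clockLaw d, openAt k U t ∉ {η | ∃ z, IsEndpoint (openGraph η) z} := by
    filter_upwards [ae_forall_not_isEndpoint (d := d) (t := t) hk] with U hU ⟨z, hz⟩ using hU z hz
  filter_upwards [ae_modify_notMem ht0 ht1 hnull, ae_openDegree_le d k t] with U hU hdeg x hx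
  obtain ⟨F, hF⟩ :=
    exists_modify_isEndpoint (fun v => (hdeg v).trans (by exact_mod_cast hk)) hx
  have := hU ∅ F (Finset.empty_subset _)
  rw [Finset.coe_empty, Set.union_empty] at this
  exact this (openDegree_sdiff_le hdeg _) hF

theorem ae_not_threeInfinite (ht0 : 0 < t) (ht1 : t < 1) (hk : 3 ≤ k) :
    ∀ᵐ U ∂clockLaw d, ¬ ∃ a b c, ThreeInfinite (graphAt k t U) a b c := by
  have hnull : ∀ᵐ U ∂clockLaw d, openAt k U t ∉ {η | ∃ z, IsTrifurcation (openGraph η) z} := by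
    filter_upwards [ae_forall_not_isTrifurcation (d := d) (k := k) (t := t)] with U hU ⟨z, hz⟩
      using hU z hz
  filter_upwards [ae_modify_notMem ht0 ht1 hnull, ae_openDegree_le d k t] with U hU hdeg
  rintro ⟨a, b, c, h⟩
  obtain ⟨A, F, hAF, hle, hz⟩ := exists_modify_isTrifurcation hk hdeg h
  exact hU A F hAF hle hz

theorem ae_not_twoInfinite (hd : 0 < d) (ht0 : 0 < t) (ht1 : t < 1) :
    ∀ᵐ U ∂clockLaw d, ¬ ∃ a b, TwoInfinite (graphAt k t U) a b := by
  by_cases hk : k ≤ 2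
  · filter_upwards [ae_not_infinite_of_le_two (d := d) ht0 ht1 hk] with U hU
    rintro ⟨a, b, ⟨ha, -⟩, -⟩
    exact hU a ha
  refine (ae_forall_not_twoInfinite_or_ae_exists hd).resolve_right fun htwo => ?_
  have h3 := ae_not_threeInfinite (d := d) (k := k) ht0 ht1 (by omega)
  have hnull : ∀ᵐ U ∂clockLaw d, openAt k U t ∉ {η | ∃ a b c, ThreeInfinite (openGraph η) a b c} := h3
  have hnull' : ∀ᵐ U ∂clockLaw d, openAt k U t ∉ {η | ¬ ∃ a b, TwoInfinite (openGraph η) a b} := by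
    filter_upwards [htwo] with U hU using not_not.2 hU
  have hfalse : ∀ᵐ U ∂clockLaw d, False := by
    filter_upwards [ae_modify_notMem ht0 ht1 hnull, ae_modify_notMem ht0 ht1 hnull',
      ae_openDegree_le d k t, htwo] with U hU hU' hdeg ⟨a, b, hab⟩
    obtain ⟨A, F, hAF, hle, hjoin⟩ := exists_modify_join (by omega) hdeg hab
    -- With `A = ∅` the modification only closes `F`, which must not produce three infinite
    -- components. The joined configuration cannot drop below two either, as that is also null.
    have h1 := hU ∅ F (Finset.empty_subset _)
    rw [Finset.coe_empty, Set.union_empty] at h1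
    exact h1 (openDegree_sdiff_le hdeg _) (hjoin (not_not.1 (hU' A F hAF hle)))
  exact hfalse.exists.choose_spec

/-- At time 0 no clock has rung, so all clusters are singletons; finite energy is not available
here. -/
theorem ae_not_twoInfinite_zero (d k : ℕ) :
    ∀ᵐ U ∂clockLaw d, ¬ ∃ a b, TwoInfinite (graphAt k 0 U) a b := by
  filter_upwards [ae_ne d 0] with U hU
  rintro ⟨a, b, ⟨ha, -⟩, -⟩
  refine ha ((Set.finite_singleton a).subset fun y hy => ?_)
  exact reachable_induction (p := fun y => y = a) rfl
    (fun x y _ _ (hxy : (graphAt k 0 U).Adj x y) =>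
      absurd (le_antisymm hxy.2.2 bot_le) (hU (mkEdge hxy.1))) hy

theorem numInfiniteClusters_eq_zero_or_one (h : ¬ ∃ a b, TwoInfinite (openGraph η) a b) :
    numInfiniteClusters η = 0 ∨ numInfiniteClusters η = 1 := by
  have hle : numInfiniteClusters η ≤ 1 := by
    refine Set.encard_le_one_iff.2 fun C D hC hD => ?_
    induction C using SimpleGraph.ConnectedComponent.ind with | _ a
    induction D using SimpleGraph.ConnectedComponent.ind with | _ b
    by_contra hne
    have hsupp : ∀ x, ((openGraph η).connectedComponentMk x).supp = cluster (openGraph η) x := by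
      intro x
      ext y
      rw [SimpleGraph.ConnectedComponent.mem_supp_iff, SimpleGraph.ConnectedComponent.eq]
      exact SimpleGraph.reachable_comm
    refine h ⟨a, b, ⟨?_, ?_⟩, fun hab => hne (SimpleGraph.ConnectedComponent.eq.2 hab)⟩
    · rw [← hsupp]; exact hC
    · rw [← hsupp]; exact hD
  rcases hle.lt_or_eq with hlt | heq
  · exact Or.inl (Order.lt_one_iff.1 hlt)
  · exact Or.inr heq

end Uniqueness

end CDP

theorem theorem1 (d k : ℕ) (hk : 1 ≤ k) (hkd : k ≤ 2 * d) (t : unitInterval) (ht : t < 1) :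
    ∀ᵐ U ∂(CDP.clockLaw d),
      (∃! ω : unitInterval → Set (CDP.Edge d), CDP.IsTrajectory k U ω) ∧
      ∀ ω : unitInterval → Set (CDP.Edge d), CDP.IsTrajectory k U ω →
        CDP.numInfiniteClusters (ω t) = 0 ∨ CDP.numInfiniteClusters (ω t) = 1 := by
  have h2 : ∀ᵐ U ∂CDP.clockLaw d, ¬ ∃ a b, CDP.TwoInfinite (CDP.graphAt k t U) a b := by
    rcases eq_or_ne t 0 with rfl | ht0
    · exact CDP.ae_not_twoInfinite_zero d k
    · exact CDP.ae_not_twoInfinite (by omega) (unitInterval.pos_iff_ne_zero.2 ht0) ht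
  filter_upwards [CDP.ae_wellOrderedClocks d, h2] with U hU h2
  refine ⟨CDP.existsUnique_isTrajectory hk hU, fun ω hω => ?_⟩
  rw [hω.eq hU (CDP.isTrajectory_openAt hk hU)]
  exact CDP.numInfiniteClusters_eq_zero_or_one h2
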